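/- For a field $F$, let $K_2(F)=F^*\otimes_{\mathbb Z}F^*/\langle a\otimes(1-a) : a\in F,\ a\neq 0,1\rangle$, written additively, and let $\{a,b\}$ denote the class of $a\otimes b$. Let $C$ be a non-singular, projective, geometrically irreducible curve over $\mathbb Q$ with function field $F=\mathbb Q(C)$. Let $$K_2^T(C)=\ker\Bigl(K_2(F)\to\bigoplus_{x\in C(\overline{\mathbb Q})}\overline{\mathbb Q}^*\Bigr),$$ where the $x$-component of the map is the tame symbol $T_x\{a,b\}=(-1)^{\mathrm{ord}_x(a)\,\mathrm{ord}_x(b)}\,\dfrac{a^{\mathrm{ord}_x(b)}}{b^{\mathrm{ord}_x(a)}}(x)$, and let $K_2^T(C)/\mathrm{torsion}$ be its quotient by the torsion subgroup. Let $P_1,P_2,P_3\in C(\mathbb Q)$ be distinct points, with indices in $\mathbb Z/3\mathbb Z$, such that all differences $(P_i)-(P_j)$ have finite order in $\mathrm{Pic}^0(C)$. Let $m_i$ be the order of the class of $(P_{i+1})-(P_{i-1})$ in $\mathrm{Pic}^0(C)$. Then there are $f_i\in F^*$ with $$\mathrm{div}(f_i)=m_i(P_{i+1})-m_i(P_{i-1})\qquad(i\in\mathbb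 Z/3\mathbb Z),$$ and for every choice of such $f_i$ the following holds. Put $$S_i=\Bigl\{\frac{f_{i+1}}{f_{i+1}(P_{i+1})},\ \frac{f_{i-1}}{f_{i-1}(P_{i-1})}\Bigr\}\in K_2(F)\qquad(i\in\mathbb Z/3\mathbb Z).$$ 1. The $S_i$ lie in $K_2^T(C)$, and there is a unique element $\{P_1,P_2,P_3\}$ of $K_2^T(C)/\mathrm{torsion}$ such that in this group $$S_i=\frac{\mathrm{lcm}(m_1,m_2,m_3)}{m_i}\,\{P_1,P_2,P_3\}\qquad\text{for } i=1,2,3.$$ 2. This element does not depend on the choice of the $f_i$, it is unchanged under even permutations of the points, and it changes sign under odd ones: for every permutation $\sigma$ of $\{1,2,3\}$, $$\{P_{\sigma(1)},P_{\sigma(2)},P_{\sigma(3)}\}=\mathrm{sgn}(\sigma)\,\{P_1,P_2,P_3\},$$ where the left-hand side is obtained in the same way from the points $P_{\sigma(1)},P_{\sigma(2)},P_{\sigma(3)}$. -/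

import Mathlib

open CategoryTheory AlgebraicGeometry
open scoped TensorProduct

noncomputable section

/-! ### `K₂` of a field, by generators and relations -/

/-- The subgroup of `Fˣ ⊗ Fˣ` generated by the elements `a ⊗ (1 - a)`, for `a ≠ 0, 1` in `F`. -/
def steinbergSubgroup (F : Type*) [Field F] : AddSubgroup (Additive Fˣ ⊗[ℤ] Additive Fˣ) :=
  AddSubgroup.closure
    {t | ∃ a b : Fˣ, (b : F) = 1 - (a : F) ∧ t = Additive.ofMul a ⊗ₜ[ℤ] Additive.ofMul b}

/-- `K₂(F) = Fˣ ⊗ Fˣ / ⟨a ⊗ (1 - a)⟩`, written additively. -/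
abbrev K2 (F : Type*) [Field F] : Type _ :=
  (Additive Fˣ ⊗[ℤ] Additive Fˣ) ⧸ steinbergSubgroup F

/-- The symbol `{a, b}` in `K₂(F)`. -/
def K2.symbol {F : Type*} [Field F] (a b : Fˣ) : K2 F :=
  QuotientAddGroup.mk (Additive.ofMul a ⊗ₜ[ℤ] Additive.ofMul b)

/-! ### Curves -/

/-- A non-singular, projective, geometrically irreducible curve over `ℚ`: an integral scheme `X`
of dimension one, proper (for curves this is the same as projective) and geometrically irreducible
over `ℚ`, all of whose local rings are regular. -/
structure CurveOverQ where
  /-- the underlying scheme -/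
  X : Scheme.{0}
  /-- the structure morphism -/
  π : X ⟶ Spec (.of ℚ)
  isIntegral : IsIntegral X
  isProper : IsProper π
  geometricallyIrreducible : GeometricallyIrreducible π
  regular : ∀ x : X, IsRegularLocalRing (X.presheaf.stalk x)
  dim_eq_one : topologicalKrullDim X = 1

namespace CurveOverQ

variable (C : CurveOverQ)

instance : IsIntegral C.X := C.isIntegral
instance : IsProper C.π := C.isProper
instance : GeometricallyIrreducible C.π := C.geometricallyIrreducible

instance : IsLocallyNoetherian C.X := LocallyOfFiniteType.isLocallyNoetherian C.π

/-- The function field `F = ℚ(C)`. -/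
abbrev F : Type := C.X.functionField

/-- The local ring of `C` at `x`. -/
abbrev localRing (x : C.X) : Type := C.X.presheaf.stalk x

/-- The inclusion of the constants `ℚ` in the function field. -/
def const : ℚ →+* C.F :=
  ((Scheme.ΓSpecIso (.of ℚ)).inv ≫ C.π.appTop ≫
    C.X.presheaf.germ ⊤ (genericPoint C.X) trivial).hom

/-- `C(K)`: the points of `C` with values in an extension field `K` of `ℚ`, that is, the morphisms
`Spec K ⟶ C` over `Spec ℚ`. -/
structure Point (K : Type) [Field K] [Algebra ℚ K] where
  /-- the underlying morphism of schemes -/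
  hom : Spec (.of K) ⟶ C.X
  hom_comp : hom ≫ C.π = Spec.map (CommRingCat.ofHom (algebraMap ℚ K))

/-- The order of vanishing at `x` of a non-zero rational function. -/
def ordAt (x : C.X) : Additive C.Fˣ →+ ℤ where
  toFun f := Scheme.ord ((f.toMul : C.Fˣ) : C.F) x
  map_zero' := by
    have := Scheme.ord_mul (x := x) (f := (1 : C.F)) (g := 1) one_ne_zero one_ne_zero
    simp only [mul_one, left_eq_add] at this
    exact this
  map_add' f g := by
    exact Scheme.ord_mul (x := x) (Units.ne_zero f.toMul) (Units.ne_zero g.toMul)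

lemma coheight_le_one (x : C.X) : Order.coheight x ≤ 1 := by
  have h1 : Order.krullDim C.X = 1 := by
    rw [← C.dim_eq_one, topologicalKrullDim]
    exact (Order.krullDim_eq_of_orderIso
      (irreducibleSetEquivPoints (α := C.X))).symm
  have h2 := Order.coheight_le_krullDim x
  rw [h1] at h2
  exact_mod_cast h2

lemma isPrincipalIdealRing (x : C.X) : IsPrincipalIdealRing (C.localRing x) := by
  have := C.regular x
  refine ((tfae_of_isNoetherianRing_of_isLocalRing_of_isDomain (C.localRing x)).out 5 0).mp ?_
  have h := (IsRegularLocalRing.iff_finrank_cotangentSpace (C.localRing x)).mp this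
  rw [ringKrullDim_stalk_eq_coheight] at h
  have := C.coheight_le_one x
  have h' : ((Module.finrank (IsLocalRing.ResidueField (C.localRing x))
    (IsLocalRing.CotangentSpace (C.localRing x)) : ℕ∞)) = Order.coheight x := by exact_mod_cast h
  rw [← h'] at this
  exact_mod_cast this

lemma isDVR {x : C.X} (hx : Order.coheight x = 1) :
    IsDiscreteValuationRing (C.localRing x) := by
  have := C.isPrincipalIdealRing x
  have h : ¬ IsField (C.localRing x) := by
    intro h
    have h2 := ringKrullDim_eq_zero_of_isField h
    rw [ringKrullDim_stalk_eq_coheight, hx] at h2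
    exact absurd h2 (by decide)
  have h3 : IsDedekindDomain (C.localRing x) := inferInstance
  exact ((IsDiscreteValuationRing.TFAE (C.localRing x) h).out 2 0).mp h3

lemma isField {x : C.X} (hx : Order.coheight x ≠ 1) : IsField (C.localRing x) := by
  have h0 : Order.coheight x = 0 := by
    have := C.coheight_le_one x
    exact Order.lt_one_iff.mp (lt_of_le_of_ne this hx)
  have : Ring.KrullDimLE 0 (C.localRing x) := krullDimLE_of_coheight_le (n := 0) (by simp [h0])
  exact Ring.KrullDimLE.isField_of_isDomain

lemma exists_unit_of_ordAt_eq_zero {x : C.X} {f : C.Fˣ} (h : C.ordAt x (.ofMul f) = 0) :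
    ∃ u : (C.localRing x)ˣ, Units.map (algebraMap (C.localRing x) C.F).toMonoidHom u = f := by
  by_cases hx : Order.coheight x = 1
  · have := C.isDVR hx
    have h1 : Scheme.ordHom x hx (f : C.F) = 1 := by
      have := (Scheme.ord_eq_iff hx (f := (f : C.F)) f.ne_zero (n := 0)).mp h
      simpa using this
    obtain ⟨u, hu⟩ := Ring.associated_of_ordFrac_eq (R := C.localRing x) (1 : C.F) (f : C.F)
      (by rw [map_one]; exact h1.symm)
    refine ⟨u, Units.ext ?_⟩
    rw [← hu]
    simp [Units.smul_def, Algebra.smul_def]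
  · have hf := C.isField hx
    obtain ⟨a, ha⟩ := (IsFractionRing.surjective_iff_isField (R := C.localRing x) (K := C.F)).mpr hf f
    have ha0 : a ≠ 0 := by
      rintro rfl
      rw [map_zero] at ha
      exact f.ne_zero ha.symm
    obtain ⟨b, hb⟩ := hf.mul_inv_cancel ha0
    exact ⟨Units.mkOfMulEqOne a b hb, Units.ext ha⟩

lemma ordAt_units_map (x : C.X) (u : (C.localRing x)ˣ) :
    C.ordAt x (.ofMul (Units.map (algebraMap (C.localRing x) C.F).toMonoidHom u)) = 0 := by
  change Scheme.ord (algebraMap (C.localRing x) C.F u) x = 0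
  by_cases hx : Order.coheight x = 1
  · have : Ring.KrullDimLE 1 (C.localRing x) := krullDimLE_of_coheight_le hx.le
    refine (Scheme.ord_eq_iff hx ?_).mpr ?_
    · exact (u.isUnit.map (algebraMap (C.localRing x) C.F)).ne_zero
    · exact Ring.ordFrac_of_isUnit u.isUnit
  · exact Scheme.ord_eq_zero_of_coheight_neq_one hx _

/-! ### Values of functions and tame symbols -/

variable {C} {K : Type} [Field K] [Algebra ℚ K]

/-- The point of the scheme underlying a `K`-valued point. -/
def Point.center (p : C.Point K) : C.X := p.hom (IsLocalRing.closedPoint K)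

/-- Evaluation at a `K`-valued point of the functions that are regular there. -/
def Point.eval (p : C.Point K) : C.localRing p.center →+* K :=
  (Scheme.stalkClosedPointTo p.hom).hom

/-- The order at a `K`-valued point of a non-zero rational function. -/
abbrev Point.ord (p : C.Point K) (f : C.Fˣ) : ℤ := C.ordAt p.center (.ofMul f)

open Classical in
/-- The value `f(p)` of a rational function `f` of order zero at `p`. (It is only meant for such
`f`; for other `f` the value is set to `1`.) -/
def Point.value (p : C.Point K) (f : C.Fˣ) : Kˣ :=
  if h : ∃ u : (C.localRing p.center)ˣ,
      Units.map (algebraMap (C.localRing p.center) C.F).toMonoidHom u = f then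
    Units.map p.eval.toMonoidHom h.choose
  else 1

lemma Point.value_units_map (p : C.Point K) (u : (C.localRing p.center)ˣ) :
    p.value (Units.map (algebraMap (C.localRing p.center) C.F).toMonoidHom u) =
      Units.map p.eval.toMonoidHom u := by
  have h : ∃ v : (C.localRing p.center)ˣ,
      Units.map (algebraMap (C.localRing p.center) C.F).toMonoidHom v =
        Units.map (algebraMap (C.localRing p.center) C.F).toMonoidHom u := ⟨u, rfl⟩
  rw [Point.value, dif_pos h]
  congr 1
  exact Units.map_injective (IsFractionRing.injective (C.localRing p.center) C.F) h.choose_spec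

lemma Point.value_mul (p : C.Point K) {f g : C.Fˣ} (hf : p.ord f = 0) (hg : p.ord g = 0) :
    p.value (f * g) = p.value f * p.value g := by
  obtain ⟨u, rfl⟩ := C.exists_unit_of_ordAt_eq_zero hf
  obtain ⟨v, rfl⟩ := C.exists_unit_of_ordAt_eq_zero hg
  rw [← map_mul, value_units_map, value_units_map, value_units_map, map_mul]

/-- The function `(-1)^(ord a * ord b) * a^(ord b) / b^(ord a)`, of order zero at `p`. -/
def Point.tameFun (p : C.Point K) (a b : C.Fˣ) : C.Fˣ :=
  (-1) ^ (p.ord a * p.ord b) * (a ^ p.ord b / b ^ p.ord a)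

lemma Point.ord_one (p : C.Point K) : p.ord 1 = 0 := by
  simp [Point.ord]

lemma Point.ord_mul (p : C.Point K) (f g : C.Fˣ) : p.ord (f * g) = p.ord f + p.ord g := by
  simp [Point.ord]

lemma Point.ord_zpow (p : C.Point K) (f : C.Fˣ) (n : ℤ) : p.ord (f ^ n) = n * p.ord f := by
  simp [Point.ord]

lemma Point.ord_neg_one (p : C.Point K) : p.ord (-1) = 0 := by
  have h : p.ord ((-1) * (-1)) = 0 := by simp [Point.ord]
  rw [Point.ord_mul] at h
  omega

lemma Point.ord_tameFun (p : C.Point K) (a b : C.Fˣ) : p.ord (p.tameFun a b) = 0 := by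
  rw [Point.tameFun, div_eq_mul_inv, ← zpow_neg, ord_mul, ord_mul, ord_zpow, ord_zpow, ord_zpow,
    ord_neg_one]
  ring

lemma Point.tameFun_mul_left (p : C.Point K) (a a' b : C.Fˣ) :
    p.tameFun (a * a') b = p.tameFun a b * p.tameFun a' b := by
  simp only [Point.tameFun, ord_mul, add_mul, zpow_add, mul_zpow, div_eq_mul_inv, mul_inv]
  ac_rfl

lemma Point.tameFun_mul_right (p : C.Point K) (a b b' : C.Fˣ) :
    p.tameFun a (b * b') = p.tameFun a b * p.tameFun a b' := by
  simp only [Point.tameFun, ord_mul, mul_add, zpow_add, mul_zpow, div_eq_mul_inv, mul_inv]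
  ac_rfl

/-- The tame symbol at `p`, on pairs of functions:
`T_p(a, b) = (-1)^(ord a * ord b) * (a^(ord b) / b^(ord a))(p)`. -/
def Point.tame (p : C.Point K) (a b : C.Fˣ) : Kˣ := p.value (p.tameFun a b)

/-- The tame symbol at `p` on `Fˣ ⊗ Fˣ`. -/
def Point.tameTensor (p : C.Point K) : Additive C.Fˣ ⊗[ℤ] Additive C.Fˣ →+ Additive Kˣ :=
  TensorProduct.liftAddHom
    (AddMonoidHom.mk' (fun a => AddMonoidHom.mk'
        (fun b => Additive.ofMul (p.tame a.toMul b.toMul))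
        (fun b b' => by
          simp only [Point.tame, toMul_add, Point.tameFun_mul_right]
          rw [Point.value_mul p (p.ord_tameFun _ _) (p.ord_tameFun _ _)]; rfl))
      (fun a a' => by
        refine AddMonoidHom.ext fun b => ?_
        change Additive.ofMul (p.value (p.tameFun (a.toMul * a'.toMul) b.toMul)) = _
        rw [Point.tameFun_mul_left, Point.value_mul p (p.ord_tameFun _ _) (p.ord_tameFun _ _)]; rfl))
    (fun n a b => by rw [map_zsmul, AddMonoidHom.zsmul_apply, map_zsmul])

lemma Point.value_zpow_eq_one (p : C.Point K) {f : C.Fˣ} {u : C.localRing p.center}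
    (hu : IsUnit u) (huf : algebraMap (C.localRing p.center) C.F u = f) (h1 : p.eval u = 1)
    (n : ℤ) : p.ord f = 0 ∧ p.value (f ^ n) = 1 := by
  obtain ⟨v, rfl⟩ := hu
  have : f = Units.map (algebraMap (C.localRing p.center) C.F).toMonoidHom v :=
    Units.ext huf.symm
  subst this
  refine ⟨C.ordAt_units_map _ _, ?_⟩
  rw [← map_zpow, value_units_map, map_zpow]
  have h2 : Units.map p.eval.toMonoidHom v = 1 := Units.ext h1
  rw [h2, one_zpow]

lemma Point.ord_of_isUnit (p : C.Point K) {f : C.Fˣ} {u : C.localRing p.center}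
    (hu : IsUnit u) (huf : algebraMap (C.localRing p.center) C.F u = f) : p.ord f = 0 := by
  obtain ⟨v, rfl⟩ := hu
  have : f = Units.map (algebraMap (C.localRing p.center) C.F).toMonoidHom v :=
    Units.ext huf.symm
  subst this
  exact C.ordAt_units_map _ _

lemma Point.eval_eq_zero (p : C.Point K) {u : C.localRing p.center} (hu : ¬ IsUnit u) :
    p.eval u = 0 := by
  by_contra h
  have : IsLocalHom p.eval := Scheme.isLocalHom_stalkClosedPointTo' p.hom
  exact hu (isUnit_of_map_unit p.eval u (isUnit_iff_ne_zero.mpr h))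

lemma Point.tame_steinberg (p : C.Point K) (a b : C.Fˣ) (h : (b : C.F) = 1 - (a : C.F)) :
    p.tame a b = 1 := by
  have hpir := C.isPrincipalIdealRing p.center
  have hval : ValuationRing (C.localRing p.center) := inferInstance
  have value_one : p.value 1 = 1 := by
    have := p.value_units_map 1
    rwa [map_one, map_one] at this
  have key : ∀ r : C.localRing p.center, algebraMap (C.localRing p.center) C.F r = a →
      p.tame a b = 1 := by
    intro r hr
    have hb : algebraMap (C.localRing p.center) C.F (1 - r) = b := by
      rw [map_sub, map_one, hr, h]
    by_cases h1 : IsUnit r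
    · have ha0 := p.ord_of_isUnit h1 hr
      by_cases h2 : IsUnit (1 - r)
      · have hb0 := p.ord_of_isUnit h2 hb
        rw [Point.tame, Point.tameFun, ha0, hb0]
        simpa using value_one
      · have he : p.eval r = 1 := by
          have := p.eval_eq_zero h2
          rw [map_sub, map_one, sub_eq_zero] at this
          exact this.symm
        rw [Point.tame, Point.tameFun, ha0]
        simpa using (p.value_zpow_eq_one h1 hr he (p.ord b)).2
    · have h2 : IsUnit (1 - r) := (IsLocalRing.isUnit_or_isUnit_one_sub_self r).resolve_left h1
      have he : p.eval (1 - r) = 1 := by rw [map_sub, map_one, p.eval_eq_zero h1, sub_zero]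
      have hb0 := p.ord_of_isUnit h2 hb
      rw [Point.tame, Point.tameFun, hb0]
      simpa using (p.value_zpow_eq_one h2 hb he (-p.ord a)).2
  rcases ValuationRing.isInteger_or_isInteger (C.localRing p.center) (a : C.F) with
    ⟨r, hr⟩ | ⟨r, hr⟩
  · exact key r hr
  by_cases h1 : IsUnit r
  · obtain ⟨v, rfl⟩ := h1
    refine key (↑v⁻¹) ?_
    rw [← inv_inj, ← hr]
    refine inv_eq_of_mul_eq_one_left ?_
    rw [← map_mul, Units.mul_inv, map_one]
  have h2 : IsUnit (1 - r) := (IsLocalRing.isUnit_or_isUnit_one_sub_self r).resolve_left h1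
  have he : p.eval (1 - r) = 1 := by rw [map_sub, map_one, p.eval_eq_zero h1, sub_zero]
  have hw : algebraMap (C.localRing p.center) C.F (1 - r) = ((-1 * b * a⁻¹ : C.Fˣ) : C.F) := by
    rw [map_sub, map_one, hr]
    simp only [Units.val_mul, Units.val_neg, Units.val_one, Units.val_inv_eq_inv_val, h]
    field_simp
    ring
  have hord : p.ord (-1 * b * a⁻¹) = 0 := p.ord_of_isUnit h2 hw
  have hab : p.ord b = p.ord a := by
    have hinv : p.ord a⁻¹ = - p.ord a := by simp [Point.ord]
    rw [ord_mul, ord_mul, ord_neg_one, hinv] at hord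
    omega
  have hfun : p.tameFun a b = (-1 * b * a⁻¹) ^ (-p.ord a) := by
    rw [Point.tameFun, hab, mul_zpow, mul_zpow, inv_zpow', neg_neg, div_eq_mul_inv, ← zpow_neg,
      mul_comm (a ^ _), ← mul_assoc]
    congr 2
    rcases Int.even_or_odd (p.ord a) with hn | hn
    · rw [Even.neg_one_zpow (hn.mul_left _), Even.neg_one_zpow hn.neg]
    · rw [Odd.neg_one_zpow (hn.mul hn), Odd.neg_one_zpow hn.neg]
  rw [Point.tame, hfun]
  exact (p.value_zpow_eq_one h2 hw he _).2

/-- The tame symbol `T_p : K₂(F) → Kˣ` at a `K`-valued point `p`. -/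
def Point.tameSymbol (p : C.Point K) : K2 C.F →+ Additive Kˣ :=
  QuotientAddGroup.lift (steinbergSubgroup C.F) p.tameTensor (by
    rw [steinbergSubgroup, AddSubgroup.closure_le]
    rintro _ ⟨a, b, h, rfl⟩
    change Additive.ofMul (p.tame a b) = 0
    rw [p.tame_steinberg a b h]
    rfl)

variable (C)

/-- `K₂ᵀ(C)`: the elements of `K₂(F)` with trivial tame symbol at all points of `C(ℚ̄)`. -/
def K2T : AddSubgroup (K2 C.F) :=
  ⨅ p : C.Point (AlgebraicClosure ℚ), p.tameSymbol.ker

/-- The quotient of `K₂ᵀ(C)` by its torsion subgroup. -/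
abbrev K2TModTorsion : Type := C.K2T ⧸ AddCommGroup.torsion C.K2T

/-! ### Divisors -/

/-- The closed points of `C`. -/
abbrev ClosedPoint : Type := {x : C.X // IsClosed ({x} : Set C.X)}

/-- The group of divisors of `C`. -/
abbrev Div : Type := C.ClosedPoint →₀ ℤ

/-- The degree of a divisor; a closed point `x` has degree `[κ(x) : ℚ]`. -/
def degree : C.Div →+ ℤ :=
  Finsupp.liftAddHom fun x => (C.π.residueDegree x.1 : ℤ) • AddMonoidHom.id ℤ

variable {C} in
/-- `D` is the divisor of `f`. -/
def IsDivisorOf (D : C.Div) (f : C.Fˣ) : Prop :=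
  ∀ x : C.ClosedPoint, D x = C.ordAt x.1 (.ofMul f)

/-- The group of principal divisors. -/
def principal : AddSubgroup C.Div where
  carrier := {D | ∃ f : C.Fˣ, IsDivisorOf D f}
  zero_mem' := ⟨1, fun x => by simp⟩
  add_mem' := by
    rintro D E ⟨f, hf⟩ ⟨g, hg⟩
    exact ⟨f * g, fun x => by simp [hf x, hg x]⟩
  neg_mem' := by
    rintro D ⟨f, hf⟩
    exact ⟨f⁻¹, fun x => by simp [hf x]⟩

/-- The divisor class group `Pic(C)`. -/
abbrev Pic : Type := C.Div ⧸ C.principal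

/-- `Pic⁰(C)`: the classes of the divisors of degree zero. -/
def Pic0 : AddSubgroup C.Pic := C.degree.ker.map (QuotientAddGroup.mk' C.principal)

variable {C}

lemma Point.comp_eq_id (P : C.Point ℚ) : P.hom ≫ C.π = 𝟙 _ := by
  rw [P.hom_comp, ← Spec.map_id]
  rfl

lemma Point.isClosed_center (P : C.Point ℚ) : IsClosed ({P.center} : Set C.X) := by
  have : IsClosedImmersion P.hom := isClosedImmersion_of_comp_eq_id C.π P.hom P.comp_eq_id
  have h := P.hom.isClosedEmbedding.isClosedMap _ (isClosed_univ (X := Spec (.of ℚ)))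
  have h2 : P.hom '' Set.univ = {P.center} := by
    ext y
    simp only [Set.image_univ, Set.mem_range, Set.mem_singleton_iff]
    constructor
    · rintro ⟨z, rfl⟩
      exact congrArg P.hom (Subsingleton.elim z _)
    · rintro rfl
      exact ⟨_, rfl⟩
  rwa [← h2]

lemma residueDegree_of_section {X Y : Scheme.{0}} (s : Y ⟶ X) (π : X ⟶ Y) (h : s ≫ π = 𝟙 Y)
    (y : Y) : π.residueDegree (s y) = 1 := by
  have h1 : Function.Bijective ((s ≫ π).residueFieldMap y).hom := by
    have : IsOpenImmersion (s ≫ π) := by rw [h]; infer_instance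
    exact ConcreteCategory.bijective_of_isIso ((s ≫ π).residueFieldMap y)
  rw [Scheme.residueFieldMap_comp] at h1
  have h2 : Function.Injective (s.residueFieldMap y).hom := RingHom.injective _
  have h3 : Function.Bijective (π.residueFieldMap (s y)).hom := by
    refine ⟨RingHom.injective _, fun z => ?_⟩
    obtain ⟨w, hw⟩ := h1.2 ((s.residueFieldMap y).hom z)
    exact ⟨w, h2 hw⟩
  let := (π.residueFieldMap (s y)).hom.toAlgebra
  change Module.finrank _ _ = 1
  rw [← Module.finrank_self (Y.residueField (π (s y)))]
  exact ((LinearEquiv.ofBijective (Algebra.linearMap _ _) h3).finrank_eq).symm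

lemma Point.residueDegree_center (P : C.Point ℚ) : C.π.residueDegree P.center = 1 :=
  residueDegree_of_section P.hom C.π P.comp_eq_id _

/-- A rational point, as a closed point. -/
def Point.toClosedPoint (P : C.Point ℚ) : C.ClosedPoint := ⟨P.center, P.isClosed_center⟩

/-- The divisor `(P)` of a rational point. -/
def Point.toDiv (P : C.Point ℚ) : C.Div := Finsupp.single P.toClosedPoint 1

/-- The class of `(P) - (Q)` in `Pic⁰(C)`. -/
def Point.diffClass (P Q : C.Point ℚ) : C.Pic0 :=
  ⟨QuotientAddGroup.mk' C.principal (P.toDiv - Q.toDiv), P.toDiv - Q.toDiv, by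
    have h : ∀ R : C.Point ℚ, C.degree R.toDiv = 1 := fun R => by
      simp [degree, Point.toDiv, Point.toClosedPoint, R.residueDegree_center]
    change C.degree _ = 0
    rw [map_sub, h, h, sub_self], rfl⟩

/-! ### The elements attached to three rational points -/

/-- `f / f(P)`, for a function `f` of order zero at `P`. -/
def Point.normalize (P : C.Point ℚ) (f : C.Fˣ) : C.Fˣ :=
  f / Units.map C.const.toMonoidHom (P.value f)

/-- `mᵢ`: the order of the class of `(Pᵢ₊₁) - (Pᵢ₋₁)` in `Pic⁰(C)`. -/
def tripleOrder (P : ZMod 3 → C.Point ℚ) (i : ZMod 3) : ℕ :=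
  addOrderOf ((P (i + 1)).diffClass (P (i - 1)))

/-- `div(fᵢ) = mᵢ (Pᵢ₊₁) - mᵢ (Pᵢ₋₁)` for all `i` in `ℤ/3ℤ`. -/
def IsTripleFunctions (P : ZMod 3 → C.Point ℚ) (f : ZMod 3 → C.Fˣ) : Prop :=
  ∀ i, IsDivisorOf (tripleOrder P i • (P (i + 1)).toDiv - tripleOrder P i • (P (i - 1)).toDiv) (f i)

/-- `Sᵢ = {fᵢ₊₁ / fᵢ₊₁(Pᵢ₊₁), fᵢ₋₁ / fᵢ₋₁(Pᵢ₋₁)}` in `K₂(F)`. -/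
def tripleS (P : ZMod 3 → C.Point ℚ) (f : ZMod 3 → C.Fˣ) (i : ZMod 3) : K2 C.F :=
  K2.symbol ((P (i + 1)).normalize (f (i + 1))) ((P (i - 1)).normalize (f (i - 1)))

/-- The integer `lcm(m₁, m₂, m₃) / mᵢ`. -/
def tripleRatio (P : ZMod 3 → C.Point ℚ) (i : ZMod 3) : ℕ :=
  Nat.lcm (tripleOrder P 1) (Nat.lcm (tripleOrder P 2) (tripleOrder P 3)) / tripleOrder P i

/-- The property that characterizes `{P₁, P₂, P₃}`, for given functions `fᵢ`: the elements `Sᵢ` lie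
in `K₂ᵀ(C)`, and `Sᵢ = (lcm(m₁, m₂, m₃) / mᵢ) T` in `K₂ᵀ(C)/torsion` for all `i`. -/
def IsTripleElement (P : ZMod 3 → C.Point ℚ) (f : ZMod 3 → C.Fˣ) (T : C.K2TModTorsion) : Prop :=
  ∃ hS : ∀ i, tripleS P f i ∈ C.K2T, ∀ i,
    (QuotientAddGroup.mk (⟨tripleS P f i, hS i⟩ : C.K2T) : C.K2TModTorsion) = tripleRatio P i • T

end CurveOverQ
end

/-!
Write `φᵢ = fᵢ / fᵢ(Pᵢ)`, `lcm` for the least common multiple of the `mⱼ`, and `aᵢ = lcm / mᵢ`, so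
that `Sᵢ = {φᵢ₊₁, φᵢ₋₁}`.

The one input from the geometry of curves is a reciprocity law for two functions `f`, `g` with
divisors `m (A) - m (B)` and `k (B) - k (D)`, normalized by `f(D) = 1` and `g(A) = 1`: the function
`f ^ k * g ^ m` has value `(-1) ^ (m * k)` at `B` (`HasDivisor.reciprocity`). It says that the tame
symbol of `{f, g}` is trivial at `B`. As it is trivial for direct reasons at all other points, the
`Sᵢ` lie in `K₂ᵀ(C)` (`CurveOverQ.tame_eq_one`).

Weil reciprocity is not available, so the law is proved by means of the norm from `F` to `ℚ(f)`. The
degree of this extension is `m`, and the norm of a function that is regular away from `B` is a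
polynomial in `f`, whose value at `0` is the `m`-th power of the value of the function at `A`
(`HasUniqueZero.finrank_eq`, `HasUniqueZero.exists_norm_eq`). Hence the norm of `g⁻¹` is a
polynomial in `f` with value `1` at `0`. It divides a power of `f - 1`, because `g` has a pole only
at `D`, where `f = 1`. So it is `(1 - f) ^ j`. The behaviour for `f → ∞` gives `j = k` and the value
of `f ^ k * g ^ m` at `B`, up to an `m`-th root of unity in `ℚ` (`HasDivisor.value_pow_eq`), which
symmetry in `f` and `g` and a parity argument remove.

All this takes place among the valuation rings of `F` that contain `ℚ`. By the valuative criterion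
of properness they are the local rings of `C` (`CurveOverQ.exists_localRing_range_eq`).

The product `∏ φᵢ ^ aᵢ` has divisor zero, so it is constant, and reciprocity at `P₀` shows that it is
a root of unity (`CurveOverQ.IsTripleFunctions.exists_pow_prod_eq_one`). Pairing it with `φᵢ` in
`K₂(F)`, where `{φᵢ, φᵢ}` is a torsion element, gives `aᵢ₊₁ Sᵢ₋₁ = aᵢ₋₁ Sᵢ₊₁` modulo torsion. As the
`aᵢ` have no common divisor, the `Sᵢ` are the multiples `aᵢ T` of a unique `T`
(`existsUnique_eq_smul_of_smul_comm`).

A function is determined by its divisor and one non-zero value at a rational point, so the `φᵢ` do not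
depend on the choice of the `fᵢ`. An even permutation of `ℤ/3ℤ` is a translation and permutes the
`φᵢ`; an odd one is a reflection and also inverts them. As the symbol is antisymmetric, the `Sᵢ` are
permuted in the first case, and permuted and negated in the second.
-/

noncomputable section

/-! ### Lattices over the polynomial ring -/

open Polynomial in
/-- The `ℚ`-span of a basis of `M` meets `X M` only in zero, so `L` is injective on it. -/
theorem finrank_le_of_addMonoidHom_ker_le_X_smul {M : Type*} [AddCommGroup M] [Module ℚ[X] M]
    [Module.Free ℚ[X] M] [Module.Finite ℚ[X] M] {m : ℕ} (L : M →+ (Fin m → ℚ))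
    (hL : ∀ x, L x = 0 → ∃ y, x = (X : ℚ[X]) • y) : Module.finrank ℚ[X] M ≤ m := by
  by_contra! hlt
  let b := Module.finBasis ℚ[X] M
  let T : (Fin (Module.finrank ℚ[X] M) → ℚ) →+ M := AddMonoidHom.mk'
    (fun q => ∑ i, (C (q i) : ℚ[X]) • b i) (fun q r => by
      simp [add_smul, Finset.sum_add_distrib])
  obtain ⟨q, hq, hq0⟩ := Submodule.exists_mem_ne_zero_of_ne_bot
    (LinearMap.ker_ne_bot_of_finrank_lt (f := (L.comp T).toRatLinearMap) (by simpa using hlt))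
  obtain ⟨y, hy⟩ := hL (T q) hq
  refine hq0 (funext fun i => ?_)
  have h1 : b.repr (T q) i = C (q i) := by
    change b.repr (∑ i, (C (q i) : ℚ[X]) • b i) i = _
    rw [b.repr_sum_self]
  have h2 := congrArg (eval 0) h1
  rw [hy] at h2
  simpa using h2.symm

open Polynomial in
/-- Modulo `X`, multiplication by `c + z` is `c` plus a nilpotent endomorphism, so its determinant is
a power of `c`. -/
theorem eval_zero_norm_of_pow_eq_X_smul {S : Type*} [CommRing S] [Algebra ℚ[X] S]
    [Module.Free ℚ[X] S] [Module.Finite ℚ[X] S] (c : ℚ) {z r : S} {k : ℕ}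
    (hz : z ^ k = (X : ℚ[X]) • r) :
    (Algebra.norm ℚ[X] (algebraMap ℚ[X] S (C c) + z)).eval 0 = c ^ Module.finrank ℚ[X] S := by
  let b := Module.finBasis ℚ[X] S
  let M := (evalRingHom (0 : ℚ)).mapMatrix (Algebra.leftMulMatrix b z)
  have hM : IsNilpotent (-M) := by
    refine IsNilpotent.neg ⟨k, ?_⟩
    rw [← map_pow, ← map_pow, hz, map_smul]
    ext i j
    simp
  have h1 : (-M).charpoly = X ^ Module.finrank ℚ[X] S := by
    have := (Matrix.isNilpotent_charpoly_sub_pow_of_isNilpotent hM).eq_zero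
    rw [sub_eq_zero] at this
    simpa using this
  rw [Algebra.norm_eq_matrix_det b, ← coe_evalRingHom, RingHom.map_det, map_add, map_add]
  have h2 : (evalRingHom (0 : ℚ)).mapMatrix
      (Algebra.leftMulMatrix b (algebraMap ℚ[X] S (C c))) = Matrix.scalar _ c := by
    rw [AlgHom.commutes]
    ext i j
    by_cases hij : i = j <;> simp [Matrix.algebraMap_matrix_apply, hij]
  rw [h2]
  have h3 := congrArg (eval c) h1
  rw [Matrix.eval_charpoly, sub_neg_eq_add] at h3
  simpa [M] using h3

/-! ### Rational places of a field -/

/-- A place of `F` with residue field `ℚ`: a discrete valuation ring with fraction field `F`,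
given by its valuation subring, its normalized valuation `ord` and its residue map `ev`. -/
structure RationalPlace (F : Type*) [Field F] where
  /-- the valuation ring -/
  ring : ValuationSubring F
  /-- the residue map -/
  ev : ring →+* ℚ
  /-- the normalized valuation -/
  ord : Additive Fˣ →+ ℤ
  mem_ring_iff : ∀ h : Fˣ, (h : F) ∈ ring ↔ 0 ≤ ord (.ofMul h)
  ev_eq_zero_iff : ∀ (h : Fˣ) (hh : (h : F) ∈ ring), ev ⟨h, hh⟩ = 0 ↔ 0 < ord (.ofMul h)
  exists_ord_eq_one : ∃ h : Fˣ, ord (.ofMul h) = 1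

namespace RationalPlace

variable {F : Type*} [Field F] (p : RationalPlace F)

theorem ratCast_mem [CharZero F] (q : ℚ) : (q : F) ∈ p.ring := by
  have key : ∀ n : ℕ, (n : F)⁻¹ ∈ p.ring := by
    intro n
    by_cases hn : n = 0
    · simp [hn]
    let u : Fˣ := Units.mk0 (n : F) (by exact_mod_cast hn)
    have hu : (u : F) ∈ p.ring := natCast_mem p.ring n
    have h1 : ¬ 0 < p.ord (.ofMul u) := by
      rw [← p.ev_eq_zero_iff u hu]
      have : (⟨u, hu⟩ : p.ring) = (n : p.ring) := rfl
      rw [this, map_natCast]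
      exact_mod_cast hn
    have h2 : ((u⁻¹ : Fˣ) : F) ∈ p.ring := by
      rw [p.mem_ring_iff, ofMul_inv, map_neg]
      omega
    simpa [u] using h2
  rw [Rat.cast_def, div_eq_mul_inv]
  exact mul_mem (intCast_mem _ _) (key _)

/-- The first `m` coefficients of the Taylor expansion at `p`: if they vanish, then `h` vanishes to
order `m`. -/
theorem exists_taylor [CharZero F] (m : ℕ) : ∃ L : p.ring →+ (Fin m → ℚ),
    ∀ (h : Fˣ) (hh : (h : F) ∈ p.ring), L ⟨h, hh⟩ = 0 → m ≤ p.ord (.ofMul h) := by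
  induction m with
  | zero => exact ⟨0, fun h hh _ => by simpa using (p.mem_ring_iff h).1 hh⟩
  | succ m ih =>
    obtain ⟨L, hL⟩ := ih
    obtain ⟨w, hw⟩ := p.exists_ord_eq_one
    let c : ℚ →+* p.ring := (Rat.castHom F).codRestrict p.ring.toSubring p.ratCast_mem
    have hc : (p.ev.comp c) = RingHom.id ℚ := RingHom.ext_rat _ _
    have hev : ∀ r : p.ring, p.ev r = 0 → (r : F) * ((w⁻¹ : Fˣ) : F) ∈ p.ring := by
      intro r hr
      by_cases hr0 : (r : F) = 0
      · simp [hr0]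
      let u : Fˣ := Units.mk0 (r : F) hr0
      have h1 : 0 < p.ord (.ofMul u) := (p.ev_eq_zero_iff u r.2).1 hr
      have h2 : ((u * w⁻¹ : Fˣ) : F) ∈ p.ring := by
        rw [p.mem_ring_iff, ofMul_mul, ofMul_inv, map_add, map_neg, hw]
        omega
      exact h2
    -- the difference quotient `(r - r(p)) / w`
    let D : p.ring →+ p.ring := AddMonoidHom.mk'
      (fun r => ⟨((r - c (p.ev r) : p.ring) : F) * ((w⁻¹ : Fˣ) : F), hev _ (by
        rw [map_sub, sub_eq_zero]; exact (congrArg (fun f => f (p.ev r)) hc).symm)⟩)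
      (fun r s => Subtype.ext (by simp only [map_add]; push_cast; ring))
    let L' : p.ring →+ (Fin (m + 1) → ℚ) := AddMonoidHom.mk'
      (fun r => Fin.cons (p.ev r) (L (D r))) (fun r s => by
        funext i
        refine Fin.cases ?_ (fun j => ?_) i <;> simp)
    refine ⟨L', fun h hh h0 => ?_⟩
    have h1 : p.ev ⟨h, hh⟩ = 0 := congrFun h0 0
    have h2 : L (D ⟨h, hh⟩) = 0 := funext fun j => congrFun h0 j.succ
    have h3 : ((D ⟨h, hh⟩ : p.ring) : F) = ((h * w⁻¹ : Fˣ) : F) := by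
      change ((⟨h, hh⟩ - c (p.ev ⟨h, hh⟩) : p.ring) : F) * ((w⁻¹ : Fˣ) : F) = _
      rw [h1, map_zero, sub_zero]
      rfl
    have h4 := hL (h * w⁻¹) (h3 ▸ (D ⟨h, hh⟩).2) (by rw [← h2]; congr 1; exact Subtype.ext h3.symm)
    rw [ofMul_mul, ofMul_inv, map_add, map_neg, hw] at h4
    push_cast
    omega

end RationalPlace

/-- `V` contains the field `ℚ` of constants. -/
def ContainsRat {F : Type*} [Field F] [CharZero F] (V : ValuationSubring F) : Prop :=
  ∀ q : ℚ, (q : F) ∈ V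

/-- `t` has a zero of order `m` at the rational place `p` and no other zeros: its inverse lies in
all other valuation rings of `F` that contain `ℚ`. -/
structure HasUniqueZero {F : Type*} [Field F] [CharZero F] (t : Fˣ) (p : RationalPlace F)
    (m : ℕ) : Prop where
  pos : 0 < m
  ord_eq : p.ord (.ofMul t) = m
  inv_mem : ∀ V : ValuationSubring F, ContainsRat V → V ≠ p.ring → ((t⁻¹ : Fˣ) : F) ∈ V

/-! ### Integrality and valuation rings -/

section Integral

variable {F : Type*} [Field F] [CharZero F]

/-- The integral closure of a ring in a field is the intersection of the valuation rings of the
field that contain the ring. -/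
theorem isIntegral_iff_forall_valuationSubring_range_le {R K : Type*} [CommRing R] [Field K]
    [Algebra R K] (h : K) : IsIntegral R h ↔
      ∀ V : ValuationSubring K, (∀ r, algebraMap R K r ∈ V) → h ∈ V := by
  constructor
  · intro hh V hV
    let : Algebra R V := ((algebraMap R K).codRestrict V.toSubring hV).toAlgebra
    have : IsScalarTower R V K := IsScalarTower.of_algebraMap_eq fun _ => rfl
    obtain ⟨v, rfl⟩ := IsIntegrallyClosed.isIntegral_iff.1 (hh.tower_top (A := V))
    exact v.2
  · intro H
    have h1 : h ∈ (integralClosure (Subring.closure ((algebraMap R K).range : Set K))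
        K).toSubring := by
      rw [← iInf_valuationSubring_superset, Subring.mem_iInf]
      exact fun V => H V.1 fun r => V.2 ⟨r, rfl⟩
    rw [Subring.closure_eq] at h1
    obtain ⟨P, hP, hP0⟩ := (h1 : IsIntegral (algebraMap R K).range h)
    obtain ⟨Q, hQ, -, hmon⟩ := Polynomial.lifts_and_natDegree_eq_and_monic
      (f := (algebraMap R K).rangeRestrict)
      ((Polynomial.mem_lifts _).2 (Polynomial.map_surjective _
        (algebraMap R K).rangeRestrict_surjective P)) hP
    refine ⟨Q, hmon, ?_⟩
    rw [← hQ, Polynomial.eval₂_map] at hP0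
    exact hP0

theorem isIntegral_rat_iff (h : F) :
    IsIntegral ℚ h ↔ ∀ V : ValuationSubring F, ContainsRat V → h ∈ V := by
  rw [isIntegral_iff_forall_valuationSubring_range_le]
  simp_rw [eq_ratCast (algebraMap ℚ F)]
  rfl

open Polynomial in
theorem algebraMap_C_eq_ratCast [Algebra ℚ[X] F] (q : ℚ) : algebraMap ℚ[X] F (C q) = q :=
  congrArg (fun f : ℚ →+* F => f q) (RingHom.ext_rat ((algebraMap ℚ[X] F).comp C) (Rat.castHom F))

open Polynomial in
theorem isIntegral_polynomial_iff [Algebra ℚ[X] F] (h : F) :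
    IsIntegral ℚ[X] h ↔ ∀ V : ValuationSubring F, ContainsRat V →
      algebraMap ℚ[X] F X ∈ V → h ∈ V := by
  rw [isIntegral_iff_forall_valuationSubring_range_le]
  refine forall_congr' fun V => ⟨fun H hV hX => H fun f => ?_, fun H hV => H (fun q => ?_) (hV X)⟩
  · induction f using Polynomial.induction_on' with
    | add f g hf hg => rw [map_add]; exact add_mem hf hg
    | monomial n a =>
      rw [← C_mul_X_pow_eq_monomial, map_mul, map_pow, algebraMap_C_eq_ratCast]
      exact mul_mem (hV a) (pow_mem hX n)
  · rw [← algebraMap_C_eq_ratCast]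
    exact hV _

/-- A non-zero algebraic element is a unit in every valuation ring that contains `ℚ`. -/
theorem RationalPlace.transcendental_of_ord_pos {p : RationalPlace F} {t : Fˣ}
    (ht : 0 < p.ord (.ofMul t)) : Transcendental ℚ (t : F) := by
  intro halg
  have h1 : IsIntegral ℚ ((t⁻¹ : Fˣ) : F) := by
    rw [Units.val_inv_eq_inv_val]
    exact halg.isIntegral.inv
  have h2 := (p.mem_ring_iff t⁻¹).1 ((isIntegral_rat_iff _).1 h1 p.ring p.ratCast_mem)
  rw [ofMul_inv, map_neg] at h2
  omega

theorem HasUniqueZero.transcendental {t : Fˣ} {p : RationalPlace F} {m : ℕ}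
    (ht : HasUniqueZero t p m) : Transcendental ℚ (t : F) :=
  RationalPlace.transcendental_of_ord_pos (p := p) (by rw [ht.ord_eq]; exact_mod_cast ht.pos)

open Polynomial in
/-- If `h` were transcendental over `ℚ(t)`, then for each rational `c` some valuation ring would
dominate `ℚ[t, h]` at the ideal `(t, h - c)`. It is the ring of `p`, as `t` has no other zeros. But
`h` and `h - 1` cannot both vanish at `p`. -/
theorem HasUniqueZero.isAlgebraic [Algebra ℚ[X] F] {t : Fˣ} {p : RationalPlace F} {m : ℕ}
    (ht : HasUniqueZero t p m) (hX : algebraMap ℚ[X] F X = t) (h : F) : IsAlgebraic ℚ[X] h := by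
  by_contra hh
  have hinj : Function.Injective (aeval h : ℚ[X][X] →ₐ[ℚ[X]] F) := transcendental_iff_injective.1 hh
  have key : ∀ c : ℚ, h - c ∈ p.ring.nonunits := by
    intro c
    let φ : ℚ[X][X] →+* F := (aeval h : ℚ[X][X] →ₐ[ℚ[X]] F).toRingHom
    let ε : ℚ[X][X] →+* ℚ := eval₂RingHom (evalRingHom 0) c
    let I : Ideal φ.range := (RingHom.ker ε).map φ.rangeRestrict
    have hI : I ≠ ⊤ := by
      rw [Ideal.ne_top_iff_one]
      intro h1
      obtain ⟨f, hf, hf1⟩ :=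
        (Ideal.mem_map_iff_of_surjective _ φ.rangeRestrict_surjective).1 h1
      have : f = 1 := hinj (by rw [map_one]; exact congrArg Subtype.val hf1)
      rw [this, RingHom.mem_ker, map_one] at hf
      exact one_ne_zero hf
    obtain ⟨V, hV, hVI⟩ := Ideal.image_subset_nonunits_valuationSubring I hI
    have hmem : ∀ f, ε f = 0 → φ f ∈ V.nonunits := fun f hf =>
      hVI ⟨φ.rangeRestrict f, Ideal.mem_map_of_mem _ hf, rfl⟩
    have hVQ : ContainsRat V := fun q => hV ⟨C (C q), by
      change aeval h (C (C q)) = _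
      rw [aeval_C, algebraMap_C_eq_ratCast]⟩
    have ht1 : (t : F) ∈ V.nonunits := by
      rw [← hX, ← aeval_C h]
      exact hmem (C X) (by simp [ε])
    have hVp : V = p.ring := by
      by_contra hne
      have h3 := ht.inv_mem V hVQ hne
      rw [← inv_inv (t : F), V.inv_mem_nonunits_iff] at ht1
      exact ht1.elim (fun h0 => t⁻¹.ne_zero (by simp at h0)) (fun h0 => h0 (by simpa using h3))
    rw [← hVp]
    have := hmem (X - C (C c)) (by simp [ε])
    have h4 : φ (X - C (C c)) = h - c := by
      change aeval h (X - C (C c)) = _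
      rw [map_sub, aeval_X, aeval_C, algebraMap_C_eq_ratCast]
    rwa [h4] at this
  have h0 := key 0
  have h1 := key 1
  rw [ValuationSubring.mem_nonunits_iff] at h0 h1
  have h2 := p.ring.valuation.map_sub_lt h0 h1
  simp at h2

end Integral

/-! ### The degree of the function field over the field generated by one function -/

section Degree
open Polynomial

variable {F : Type*} [Field F] [CharZero F] {t : Fˣ} {p : RationalPlace F} {m : ℕ}

/-- A function regular away from the poles of `t` is divisible by `t ^ k` if it vanishes to order
`m * k` at the only zero of `t`. -/
theorem HasUniqueZero.isIntegral_mul_inv (ht : HasUniqueZero t p m) [Algebra ℚ[X] F]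
    {h : F} {k : ℕ} (hh : ∀ u : Fˣ, (u : F) = h → m * k ≤ p.ord (.ofMul u))
    (hint : IsIntegral ℚ[X] h) : IsIntegral ℚ[X] (h * ((t ^ k)⁻¹ : Fˣ)) := by
  by_cases h0 : h = 0
  · rw [h0, zero_mul]; exact isIntegral_zero
  rw [isIntegral_polynomial_iff] at hint ⊢
  intro V hV hXV
  by_cases hVp : V = p.ring
  · rw [hVp]
    have h2 : ((Units.mk0 h h0 * (t ^ k)⁻¹ : Fˣ) : F) ∈ p.ring := by
      have := hh (Units.mk0 h h0) rfl
      rw [p.mem_ring_iff, ofMul_mul, ofMul_inv, ofMul_pow, map_add, map_neg, map_nsmul, ht.ord_eq]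
      rw [nsmul_eq_mul]
      linarith [mul_comm (m : ℤ) k]
    exact h2
  · refine mul_mem (hint V hV hXV) ?_
    rw [← inv_pow]
    push_cast
    exact pow_mem (by simpa using ht.inv_mem V hV hVp) k

theorem HasUniqueZero.algebraMap_mem (ht : HasUniqueZero t p m) : (t : F) ∈ p.ring := by
  rw [p.mem_ring_iff, ht.ord_eq]; positivity

theorem HasUniqueZero.mem_of_isIntegral (ht : HasUniqueZero t p m) [Algebra ℚ[X] F]
    (hX : algebraMap ℚ[X] F X = t) {h : F} (hint : IsIntegral ℚ[X] h) : h ∈ p.ring :=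
  (isIntegral_polynomial_iff h).1 hint p.ring p.ratCast_mem
    (hX ▸ ht.algebraMap_mem)

section Lattice

variable (E L : Type*) [Field E] [Field L] [Algebra E L] [FiniteDimensional E L]
  [Algebra ℚ[X] E] [IsFractionRing ℚ[X] E] [Algebra ℚ[X] L] [IsScalarTower ℚ[X] E L]

theorem integralClosure_polynomial_free_finite :
    Module.Free ℚ[X] (integralClosure ℚ[X] L) ∧ Module.Finite ℚ[X] (integralClosure ℚ[X] L) ∧
      Module.finrank ℚ[X] (integralClosure ℚ[X] L) = Module.finrank E L := by
  have : CharZero E := charZero_of_injective_ringHom ((algebraMap ℚ[X] E).comp C).injective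
  have : FaithfulSMul ℚ[X] L := by
    rw [faithfulSMul_iff_algebraMap_injective, IsScalarTower.algebraMap_eq ℚ[X] E L]
    exact (algebraMap E L).injective.comp (IsFractionRing.injective ℚ[X] E)
  exact ⟨IsIntegralClosure.module_free ℚ[X] E L _, IsIntegralClosure.finite ℚ[X] E L _,
    IsIntegralClosure.rank ℚ[X] E L _⟩

/-- If the first `m` Taylor coefficients at `p` of an element of the integral closure of `ℚ[t]` in `L`
are zero, then the element is divisible by `t`; so the rank of this closure is at most `m`. -/
theorem HasUniqueZero.finrank_le [Algebra L F] [Algebra ℚ[X] F] [IsScalarTower ℚ[X] L F]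
    (ht : HasUniqueZero t p m) (hX : algebraMap ℚ[X] F X = t) : Module.finrank E L ≤ m := by
  obtain ⟨h1, h2, h3⟩ := integralClosure_polynomial_free_finite E L
  rw [← h3]
  have hint : ∀ s : integralClosure ℚ[X] L, IsIntegral ℚ[X] (algebraMap L F s) :=
    fun s => s.2.algebraMap
  obtain ⟨T, hT⟩ := p.exists_taylor m
  refine finrank_le_of_addMonoidHom_ker_le_X_smul (T.comp
    (((algebraMap L F).comp (algebraMap (integralClosure ℚ[X] L) L)).codRestrict p.ring.toSubring
      fun s => ht.mem_of_isIntegral hX (hint s)).toAddMonoidHom) fun s hs => ?_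
  have h4 := ht.isIntegral_mul_inv (k := 1) (h := algebraMap L F s) (fun u hu => by
    have h5 : (u : F) ∈ p.ring := hu ▸ ht.mem_of_isIntegral hX (hint s)
    have h6 := hT u h5 (by rw [← hs]; exact congrArg T (Subtype.ext hu))
    simpa using h6) (hint s)
  have hXL : algebraMap L F (algebraMap ℚ[X] L X) = t := by
    rw [← IsScalarTower.algebraMap_apply, hX]
  have h7 : algebraMap L F ((s : L) * (algebraMap ℚ[X] L X)⁻¹) =
      algebraMap L F s * ((t ^ 1)⁻¹ : Fˣ) := by
    rw [map_mul, map_inv₀, hXL]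
    simp
  rw [← h7] at h4
  have h8 : IsIntegral ℚ[X] ((s : L) * (algebraMap ℚ[X] L X)⁻¹) :=
    (isIntegral_algHom_iff (IsScalarTower.toAlgHom ℚ[X] L F) (algebraMap L F).injective).1 h4
  refine ⟨⟨_, h8⟩, Subtype.ext ?_⟩
  have hX0 : algebraMap ℚ[X] L X ≠ 0 := fun h0 => t.ne_zero (by rw [← hXL, h0, map_zero])
  change (s : L) = X • ((s : L) * (algebraMap ℚ[X] L X)⁻¹)
  rw [Algebra.smul_def]
  field_simp

end Lattice

section Norm

variable (E : Type*) [Field E] [Algebra E F] [Algebra ℚ[X] E] [IsFractionRing ℚ[X] E]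
  [Algebra ℚ[X] F] [IsScalarTower ℚ[X] E F]

/-- The bound `m` holds for every finite subextension, hence for `F`. -/
theorem HasUniqueZero.finiteDimensional (ht : HasUniqueZero t p m)
    (hX : algebraMap ℚ[X] F X = t) : FiniteDimensional E F := by
  have halg : ∀ h : F, IsIntegral E h := fun h =>
    ((IsFractionRing.isAlgebraic_iff ℚ[X] E F).1 (ht.isAlgebraic hX h)).isIntegral
  have hrank : Module.rank E F ≤ m := by
    refine rank_le fun s hs => ?_
    let L := IntermediateField.adjoin E (s : Set F)
    have : FiniteDimensional E L :=
      IntermediateField.finiteDimensional_adjoin fun x _ => halg x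
    have : IsScalarTower ℚ[X] L F :=
      IsScalarTower.of_algebraMap_eq fun x => by
        rw [IsScalarTower.algebraMap_apply ℚ[X] E F, IsScalarTower.algebraMap_apply ℚ[X] E L]
        rfl
    have h1 : LinearIndependent E (fun i : s =>
        (⟨i, IntermediateField.subset_adjoin E _ i.2⟩ : L)) :=
      LinearIndependent.of_comp L.val.toLinearMap hs
    calc s.card = Fintype.card s := (Fintype.card_coe s).symm
      _ ≤ Module.finrank E L := h1.fintype_card_le_finrank
      _ ≤ m := ht.finrank_le E L hX
  exact Module.rank_lt_aleph0_iff.1 (hrank.trans_lt (Cardinal.natCast_lt_aleph0))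

/-- The norm of a function `h` that is regular away from the poles of `t` is a polynomial in `t`, and
its value at `0` is a power of the value of `h` at the only zero of `t`. This uses that a power of
`h - h(p)` is divisible by `t`. -/
theorem HasUniqueZero.exists_norm_eq [FiniteDimensional E F] (ht : HasUniqueZero t p m)
    (hX : algebraMap ℚ[X] F X = t) {h : F} (hint : IsIntegral ℚ[X] h) (hp : h ∈ p.ring) :
    ∃ f : ℚ[X], Algebra.norm E h = algebraMap ℚ[X] E f ∧
      f.eval 0 = p.ev ⟨h, hp⟩ ^ Module.finrank E F := by
  obtain ⟨h1, h2, h3⟩ := integralClosure_polynomial_free_finite E F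
  have := IsIntegralClosure.isLocalization ℚ[X] E F (integralClosure ℚ[X] F)
  let s : integralClosure ℚ[X] F := ⟨h, hint⟩
  refine ⟨Algebra.norm ℚ[X] s,
    Algebra.norm_localization (Sₘ := F) ℚ[X] (nonZeroDivisors ℚ[X]) s, ?_⟩
  let c := p.ev ⟨h, hp⟩
  let z := s - algebraMap ℚ[X] (integralClosure ℚ[X] F) (C c)
  have hzF : (z : F) = h - c := by
    change h - algebraMap ℚ[X] F (C c) = _
    rw [algebraMap_C_eq_ratCast]
  have hz : ∃ r, z ^ m = (X : ℚ[X]) • r := by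
    have h4 := ht.isIntegral_mul_inv (k := 1) (h := (z : F) ^ m) (fun u hu => by
      have hz0 : (z : F) ≠ 0 := by
        intro h0
        rw [h0, zero_pow ht.pos.ne'] at hu
        exact u.ne_zero hu
      have hu' : u = Units.mk0 _ hz0 ^ m := Units.ext (by simpa using hu)
      have hzp : ((Units.mk0 (z : F) hz0 : Fˣ) : F) ∈ p.ring := ht.mem_of_isIntegral hX z.2
      have h5 : 0 < p.ord (.ofMul (Units.mk0 (z : F) hz0)) := by
        rw [← p.ev_eq_zero_iff _ hzp]
        have : (⟨_, hzp⟩ : p.ring) = ⟨h, hp⟩ - ((Rat.castHom F).codRestrict p.ring.toSubring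
          p.ratCast_mem) c := Subtype.ext hzF
        rw [this, map_sub, sub_eq_zero]
        exact (congrArg (fun f : ℚ →+* ℚ => f c) (RingHom.ext_rat (p.ev.comp _)
          (RingHom.id ℚ))).symm
      rw [hu', ofMul_pow, map_nsmul, nsmul_eq_mul]
      push_cast
      exact mul_le_mul_of_nonneg_left h5 (by positivity)) (z.2.pow m)
    refine ⟨⟨_, h4⟩, Subtype.ext ?_⟩
    change (z : F) ^ m = X • ((z : F) ^ m * ((t ^ 1)⁻¹ : Fˣ))
    rw [Algebra.smul_def, hX, mul_left_comm, pow_one, Units.mul_inv, mul_one]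
  obtain ⟨r, hr⟩ := hz
  have h6 := eval_zero_norm_of_pow_eq_X_smul c hr
  rw [h3] at h6
  rw [← h6]
  congr 2
  simp [z]

theorem HasUniqueZero.ev_algebraMap (ht : HasUniqueZero t p m) (hX : algebraMap ℚ[X] F X = t)
    (a : ℚ[X]) (ha : algebraMap ℚ[X] F a ∈ p.ring) : p.ev ⟨_, ha⟩ = a.eval 0 := by
  let φ : ℚ[X] →+* p.ring := (algebraMap ℚ[X] F).codRestrict p.ring.toSubring
    fun a => ht.mem_of_isIntegral hX isIntegral_algebraMap
  have h1 : p.ev.comp φ = evalRingHom 0 := by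
    refine Polynomial.ringHom_ext' (RingHom.ext_rat _ _) ?_
    have : φ X = ⟨t, ht.algebraMap_mem⟩ := Subtype.ext hX
    rw [RingHom.comp_apply, this, coe_evalRingHom, eval_X, p.ev_eq_zero_iff, ht.ord_eq]
    exact_mod_cast ht.pos
  exact congrArg (fun f => f a) h1

/-- The order at `p` of a polynomial in `t` is a multiple of `m`. -/
theorem HasUniqueZero.exists_ord_algebraMap (ht : HasUniqueZero t p m)
    (hX : algebraMap ℚ[X] F X = t) {a : ℚ[X]} (ha : a ≠ 0) :
    ∃ k : ℕ, ∀ u : Fˣ, (u : F) = algebraMap ℚ[X] F a → p.ord (.ofMul u) = m * k := by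
  obtain ⟨b, hb, hdvd⟩ := exists_eq_pow_rootMultiplicity_mul_and_not_dvd a ha 0
  rw [C_0, sub_zero, X_dvd_iff, coeff_zero_eq_eval_zero] at hdvd
  rw [C_0, sub_zero] at hb
  refine ⟨rootMultiplicity 0 a, fun u hu => ?_⟩
  have hbp : algebraMap ℚ[X] F b ∈ p.ring := ht.mem_of_isIntegral hX isIntegral_algebraMap
  have hev := ht.ev_algebraMap hX b hbp
  have hb0 : algebraMap ℚ[X] F b ≠ 0 := by
    intro h0
    have : (⟨_, hbp⟩ : p.ring) = 0 := Subtype.ext h0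
    rw [this, map_zero] at hev
    exact hdvd hev.symm
  have h1 : p.ord (.ofMul (Units.mk0 _ hb0)) = 0 := by
    refine le_antisymm (not_lt.1 fun h => hdvd ?_) ((p.mem_ring_iff (Units.mk0 _ hb0)).1 hbp)
    rw [← hev]
    exact (p.ev_eq_zero_iff (Units.mk0 _ hb0) hbp).2 h
  have h2 : u = t ^ (rootMultiplicity 0 a) * Units.mk0 _ hb0 := by
    refine Units.ext ?_
    rw [hu]
    nth_rewrite 1 [hb]
    simp [hX]
  rw [h2, ofMul_mul, ofMul_pow, map_add, h1, map_nsmul, ht.ord_eq, nsmul_eq_mul, add_zero,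
    mul_comm]

/-- Take an integral `s` whose order `N` at `p` is prime to `m`. Then `s ^ m / t ^ N` has no zero at
`p`, so its norm has none at `t = 0`; hence `m` times the order of the norm of `s` at `t = 0` is `N`
times the degree. -/
theorem HasUniqueZero.dvd_finrank [FiniteDimensional E F] (ht : HasUniqueZero t p m)
    (hX : algebraMap ℚ[X] F X = t) : m ∣ Module.finrank E F := by
  obtain ⟨w, hw⟩ := p.exists_ord_eq_one
  obtain ⟨a, ha, hint⟩ := (ht.isAlgebraic hX (w : F)).exists_integral_multiple
  obtain ⟨k, hk⟩ := ht.exists_ord_algebraMap hX ha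
  have ha0 : algebraMap ℚ[X] F a ≠ 0 := by
    have : Function.Injective (algebraMap ℚ[X] F) := by
      rw [IsScalarTower.algebraMap_eq ℚ[X] E F]
      exact (algebraMap E F).injective.comp (IsFractionRing.injective ℚ[X] E)
    exact fun h => ha (this (by rw [h, map_zero]))
  let s : Fˣ := Units.mk0 _ ha0 * w
  have hs : p.ord (.ofMul s) = m * k + 1 := by
    rw [ofMul_mul, map_add, hk _ rfl, hw]
  have hsF : (s : F) = a • (w : F) := (Algebra.smul_def a (w : F)).symm
  rw [← hsF] at hint
  let N := m * k + 1
  let b : Fˣ := s ^ m * (t ^ N)⁻¹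
  have hord : p.ord (.ofMul b) = 0 := by
    rw [ofMul_mul, ofMul_inv, ofMul_pow, ofMul_pow, map_add, map_neg, map_nsmul, map_nsmul, hs,
      ht.ord_eq, nsmul_eq_mul, nsmul_eq_mul]
    push_cast [N]
    ring
  have hbint : IsIntegral ℚ[X] (b : F) := by
    have := ht.isIntegral_mul_inv (k := N) (h := (s : F) ^ m) (fun u hu => by
      have : u = s ^ m := Units.ext (by simpa using hu)
      rw [this, ofMul_pow, map_nsmul, hs, nsmul_eq_mul]
      push_cast [N]
      rfl) (hint.pow m)
    simpa [b] using this
  have hbp : (b : F) ∈ p.ring := ht.mem_of_isIntegral hX hbint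
  obtain ⟨f, hf, -⟩ := ht.exists_norm_eq E hX hint (ht.mem_of_isIntegral hX hint)
  obtain ⟨g, hg, hg0⟩ := ht.exists_norm_eq E hX hbint hbp
  have hg1 : g.eval 0 ≠ 0 := by
    rw [hg0]
    refine pow_ne_zero _ fun h0 => ?_
    rw [p.ev_eq_zero_iff, hord] at h0
    exact lt_irrefl _ h0
  have hXE : algebraMap E F (algebraMap ℚ[X] E X) = t := by
    rw [← IsScalarTower.algebraMap_apply, hX]
  have h1 : f ^ m = g * X ^ (Module.finrank E F * N) := by
    apply IsFractionRing.injective ℚ[X] E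
    rw [map_mul, map_pow, map_pow, ← hf, ← hg, ← map_pow, pow_mul, ← Algebra.norm_algebraMap,
      ← map_pow, ← map_mul, map_pow, hXE]
    simp [b]
  have hgX : g ≠ 0 := fun h => hg1 (by rw [h, eval_zero])
  have h2 := congrArg (rootMultiplicity 0) h1
  rw [rootMultiplicity_mul (mul_ne_zero hgX (pow_ne_zero _ X_ne_zero)),
    rootMultiplicity_eq_zero hg1, zero_add, ← count_roots, ← count_roots, roots_pow, roots_pow,
    roots_X, Multiset.count_nsmul, Multiset.count_nsmul, Multiset.count_singleton_self,
    mul_one] at h2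
  have h4 : Nat.Coprime m N := by simp [N]
  exact h4.dvd_of_dvd_mul_right (Dvd.intro _ h2)

theorem HasUniqueZero.finrank_eq [FiniteDimensional E F] (ht : HasUniqueZero t p m)
    (hX : algebraMap ℚ[X] F X = t) : Module.finrank E F = m :=
  (ht.finrank_le E F hX).antisymm
    (Nat.le_of_dvd Module.finrank_pos (ht.dvd_finrank E hX))

end Norm

end Degree

section Generator
open Polynomial

theorem isFractionRing_of_adjoin_eq_top {E : Type*} [Field E] [CharZero E] [Algebra ℚ[X] E] {τ : E}
    (hX : algebraMap ℚ[X] E X = τ) (hτ : Transcendental ℚ τ)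
    (hgen : IntermediateField.adjoin ℚ {τ} = ⊤) : IsFractionRing ℚ[X] E := by
  have hev : ∀ a : ℚ[X], algebraMap ℚ[X] E a = aeval τ a := fun a =>
    congrArg (fun f : ℚ[X] →+* E => f a) (Polynomial.ringHom_ext'
      (f := algebraMap ℚ[X] E) (g := (aeval τ : ℚ[X] →ₐ[ℚ] E).toRingHom) (RingHom.ext_rat _ _)
      (by simpa using hX))
  have : FaithfulSMul ℚ[X] E := by
    rw [faithfulSMul_iff_algebraMap_injective]
    intro a b hab
    rw [hev, hev] at hab
    exact transcendental_iff_injective.1 hτ hab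
  refine IsFractionRing.of_field ℚ[X] E fun z => ?_
  obtain ⟨a, b, hab⟩ := (IntermediateField.mem_adjoin_simple_iff ℚ z).1 (by rw [hgen]; trivial)
  exact ⟨a, b, by rw [hev, hev, hab]⟩

end Generator

/-! ### Values at a rational place -/

namespace RationalPlace

variable {F : Type*} [Field F] (p : RationalPlace F)

/-- `h` is regular at the place `p` and takes the value `q` there. -/
def HasValue (h : F) (q : ℚ) : Prop := ∃ hh : h ∈ p.ring, p.ev ⟨h, hh⟩ = q

variable {p}

theorem HasValue.unique {h : F} {q r : ℚ} (hq : p.HasValue h q) (hr : p.HasValue h r) : q = r := by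
  obtain ⟨_, rfl⟩ := hq
  obtain ⟨_, rfl⟩ := hr
  rfl

theorem HasValue.mul {h k : F} {q r : ℚ} (hq : p.HasValue h q) (hr : p.HasValue k r) :
    p.HasValue (h * k) (q * r) := by
  obtain ⟨h1, rfl⟩ := hq
  obtain ⟨h2, rfl⟩ := hr
  exact ⟨mul_mem h1 h2, map_mul p.ev ⟨h, h1⟩ ⟨k, h2⟩⟩

theorem HasValue.pow {h : F} {q : ℚ} (hq : p.HasValue h q) (n : ℕ) :
    p.HasValue (h ^ n) (q ^ n) := by
  obtain ⟨h1, rfl⟩ := hq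
  exact ⟨pow_mem h1 n, map_pow p.ev ⟨h, h1⟩ n⟩

theorem exists_hasValue {h : Fˣ} (hh : 0 ≤ p.ord (.ofMul h)) : ∃ q, p.HasValue (h : F) q :=
  ⟨_, (p.mem_ring_iff h).2 hh, rfl⟩

theorem HasValue.ord_nonneg {h : Fˣ} {q : ℚ} (hq : p.HasValue (h : F) q) :
    0 ≤ p.ord (.ofMul h) := (p.mem_ring_iff h).1 hq.1

theorem HasValue.eq_zero_iff {h : Fˣ} {q : ℚ} (hq : p.HasValue (h : F) q) :
    q = 0 ↔ 0 < p.ord (.ofMul h) := by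
  obtain ⟨h1, rfl⟩ := hq
  exact p.ev_eq_zero_iff h h1

theorem hasValue_one : p.HasValue (1 : F) 1 := ⟨one_mem _, map_one p.ev⟩

theorem HasValue.sub {h k : F} {q r : ℚ} (hq : p.HasValue h q) (hr : p.HasValue k r) :
    p.HasValue (h - k) (q - r) := by
  obtain ⟨h1, rfl⟩ := hq
  obtain ⟨h2, rfl⟩ := hr
  exact ⟨sub_mem h1 h2, map_sub p.ev ⟨h, h1⟩ ⟨k, h2⟩⟩

theorem HasValue.inv {h : Fˣ} {q : ℚ} (hq : p.HasValue (h : F) q) (hq0 : q ≠ 0) :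
    p.HasValue ((h⁻¹ : Fˣ) : F) q⁻¹ := by
  have h1 : p.ord (.ofMul h) = 0 :=
    le_antisymm (not_lt.1 fun h => hq0 (hq.eq_zero_iff.2 h)) hq.ord_nonneg
  obtain ⟨r, hr⟩ := exists_hasValue (p := p) (h := h⁻¹) (by rw [ofMul_inv, map_neg, h1, neg_zero])
  have h2 := hq.mul hr
  rw [Units.mul_inv] at h2
  rwa [inv_eq_of_mul_eq_one_right (h2.unique hasValue_one)]

theorem HasValue.inv_one {h : Fˣ} (hq : p.HasValue (h : F) 1) :
    p.HasValue ((h⁻¹ : Fˣ) : F) 1 := by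
  simpa using hq.inv one_ne_zero

end RationalPlace

section AdjoinSimple

variable {F : Type*} [Field F] [CharZero F] {t : Fˣ} {p : RationalPlace F} {m : ℕ}
  {E : Type*} [Field E] [CharZero E] [Algebra E F] {τ : E}

open Polynomial in
theorem HasUniqueZero.finiteDimensional_of_adjoin_eq_top (ht : HasUniqueZero t p m)
    (hτ : algebraMap E F τ = t) (hgen : IntermediateField.adjoin ℚ {τ} = ⊤) :
    FiniteDimensional E F := by
  have htr : Transcendental ℚ τ := fun h => ht.transcendental (hτ ▸ h.algebraMap)
  let : Algebra ℚ[X] E := (aeval τ : ℚ[X] →ₐ[ℚ] E).toRingHom.toAlgebra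
  let : Algebra ℚ[X] F := ((algebraMap E F).comp (algebraMap ℚ[X] E)).toAlgebra
  have : IsScalarTower ℚ[X] E F := IsScalarTower.of_algebraMap_eq fun _ => rfl
  have hX : algebraMap ℚ[X] E X = τ := aeval_X τ
  have := isFractionRing_of_adjoin_eq_top hX htr hgen
  exact ht.finiteDimensional E (by rw [IsScalarTower.algebraMap_apply ℚ[X] E F, hX, hτ])

open Polynomial in
/-- The degree of `F` over `ℚ(t)`, and the norm down to `ℚ(t)` of a function that is regular away
from the poles of `t`. -/
theorem HasUniqueZero.exists_norm_eq_aeval [FiniteDimensional E F] (ht : HasUniqueZero t p m)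
    (hτ : algebraMap E F τ = t) (hgen : IntermediateField.adjoin ℚ {τ} = ⊤) {h : F}
    (hreg : ∀ V : ValuationSubring F, ContainsRat V → (t : F) ∈ V → h ∈ V) {q : ℚ}
    (hq : p.HasValue h q) :
    Module.finrank E F = m ∧
      ∃ a : ℚ[X], Algebra.norm E h = aeval τ a ∧ a.eval 0 = q ^ m := by
  have htr : Transcendental ℚ τ := fun h => ht.transcendental (hτ ▸ h.algebraMap)
  let : Algebra ℚ[X] E := (aeval τ : ℚ[X] →ₐ[ℚ] E).toRingHom.toAlgebra
  let : Algebra ℚ[X] F := ((algebraMap E F).comp (algebraMap ℚ[X] E)).toAlgebra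
  have : IsScalarTower ℚ[X] E F := IsScalarTower.of_algebraMap_eq fun _ => rfl
  have hX : algebraMap ℚ[X] E X = τ := aeval_X τ
  have := isFractionRing_of_adjoin_eq_top hX htr hgen
  have hXF : algebraMap ℚ[X] F X = t := by
    rw [IsScalarTower.algebraMap_apply ℚ[X] E F, hX, hτ]
  have hn := ht.finrank_eq E hXF
  have hint : IsIntegral ℚ[X] h := (isIntegral_polynomial_iff h).2 (by rwa [hXF])
  obtain ⟨a, ha, ha0⟩ := ht.exists_norm_eq E hXF hint hq.1
  exact ⟨hn, a, ha, by rw [ha0, hq.2, hn]⟩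

end AdjoinSimple

/-- An everywhere regular function is algebraic over `ℚ`, so it is equal to its value at a rational
place. -/
theorem RationalPlace.HasValue.eq_one_of_forall_mem {F : Type*} [Field F] [CharZero F]
    {p : RationalPlace F} {h : F} (hp : p.HasValue h 1)
    (hh : ∀ V : ValuationSubring F, ContainsRat V → h ∈ V) : h = 1 := by
  by_contra hne
  have h1 := hp.sub hasValue_one
  rw [sub_self] at h1
  have h2 := RationalPlace.transcendental_of_ord_pos (p := p) (t := Units.mk0 _ (sub_ne_zero.2 hne))
    ((HasValue.eq_zero_iff (h := Units.mk0 _ (sub_ne_zero.2 hne)) h1).1 rfl)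
  exact h2 ((isIntegral_rat_iff _).2 fun V hV => sub_mem (hh V hV) (one_mem V)).isAlgebraic

/-! ### The reciprocity law -/

section Reciprocity

variable {F : Type*} [Field F] [CharZero F]

/-- The divisor of `f` is `m (p) - m (q)`, with `m > 0`: `f` has order `m` at `p` and `-m` at `q`,
and it is a unit in all other valuation rings of `F` that contain `ℚ`. -/
structure HasDivisor (f : Fˣ) (p q : RationalPlace F) (m : ℕ) : Prop where
  pos : 0 < m
  ord_left : p.ord (.ofMul f) = m
  ord_right : q.ord (.ofMul f) = -m
  unit : ∀ V : ValuationSubring F, ContainsRat V → V ≠ p.ring → V ≠ q.ring →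
    (f : F) ∈ V ∧ ((f⁻¹ : Fˣ) : F) ∈ V

variable {f g : Fˣ} {A B D : RationalPlace F} {m k : ℕ}

theorem HasDivisor.inv (hf : HasDivisor f A B m) : HasDivisor f⁻¹ B A m where
  pos := hf.pos
  ord_left := by rw [ofMul_inv, map_neg, hf.ord_right, neg_neg]
  ord_right := by rw [ofMul_inv, map_neg, hf.ord_left]
  unit V hV h1 h2 := by
    rw [inv_inv]
    exact (hf.unit V hV h2 h1).symm

theorem HasDivisor.hasUniqueZero (hf : HasDivisor f A B m) : HasUniqueZero f A m where
  pos := hf.pos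
  ord_eq := hf.ord_left
  inv_mem V hV hVA := by
    by_cases hVB : V = B.ring
    · rw [hVB, B.mem_ring_iff, hf.inv.ord_left]
      positivity
    · exact (hf.unit V hV hVA hVB).2

theorem HasDivisor.notMem_right (hf : HasDivisor f A B m) : (f : F) ∉ B.ring := by
  rw [B.mem_ring_iff, hf.ord_right]
  have := hf.pos
  omega

open Polynomial in
/-- The norm of `g⁻¹` from `F` down to `ℚ(f)` is computed in two ways: as a polynomial in `f` it is
`(1 - f) ^ k`, and for `f → ∞` the norm of `(f ^ k * g ^ m)⁻¹` tends to `v⁻¹ ^ m`. -/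
theorem HasDivisor.value_pow_eq (hf : HasDivisor f A B m) (hg : HasDivisor g B D k)
    (hfD : D.HasValue (f : F) 1) (hgA : A.HasValue (g : F) 1) {v : ℚ}
    (hv : B.HasValue ((f ^ k * g ^ m : Fˣ) : F) v) : v ^ m = (-1) ^ (k * m) := by
  let E := IntermediateField.adjoin ℚ {(f : F)}
  let τ : E := IntermediateField.AdjoinSimple.gen ℚ (f : F)
  have hτ : algebraMap E F τ = f := IntermediateField.AdjoinSimple.algebraMap_gen ℚ (f : F)
  have hτ' : algebraMap E F τ⁻¹ = (f⁻¹ : Fˣ) := by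
    rw [map_inv₀, hτ, Units.val_inv_eq_inv_val]
  have hτ0 : τ ≠ 0 := fun h => f.ne_zero (by rw [← hτ, h, map_zero])
  have hgen : IntermediateField.adjoin ℚ {τ} = ⊤ := by
    refine eq_top_iff.2 fun z _ => ?_
    obtain ⟨a, b, hab⟩ := (IntermediateField.mem_adjoin_simple_iff ℚ (z : F)).1 z.2
    refine (IntermediateField.mem_adjoin_simple_iff ℚ z).2
      ⟨a, b, (algebraMap E F).injective ?_⟩
    rw [map_div₀, ← aeval_algebraMap_apply, ← aeval_algebraMap_apply, hτ]
    exact hab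
  have hgen' : IntermediateField.adjoin ℚ {τ⁻¹} = ⊤ := by
    refine eq_top_iff.2 (hgen ▸ IntermediateField.adjoin_le_iff.2 ?_)
    rintro _ rfl
    have := inv_mem (IntermediateField.mem_adjoin_simple_self ℚ τ⁻¹)
    rwa [inv_inv] at this
  have htA := hf.hasUniqueZero
  have htB := hf.inv.hasUniqueZero
  have hτtr : Transcendental ℚ τ := fun h => htA.transcendental (hτ ▸ h.algebraMap)
  have hfin := htA.finiteDimensional_of_adjoin_eq_top hτ hgen
  have hreg : ∀ V : ValuationSubring F, ContainsRat V → V ≠ B.ring → ((g⁻¹ : Fˣ) : F) ∈ V := by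
    intro V hV hVB
    by_cases hVD : V = D.ring
    · rw [hVD, D.mem_ring_iff, hg.inv.ord_left]
      positivity
    · exact (hg.unit V hV hVB hVD).2
  have hfB : ∀ V : ValuationSubring F, (f : F) ∈ V → V ≠ B.ring := by
    rintro V h rfl
    exact hf.notMem_right h
  -- the norm of `g⁻¹` is a polynomial in `f` with value `1` at zero
  obtain ⟨hn, a, ha, ha0⟩ := htA.exists_norm_eq_aeval hτ hgen
    (fun V hV h => hreg V hV (hfB V h)) hgA.inv_one
  rw [one_pow] at ha0
  have hN : ∀ e : E, Algebra.norm E (algebraMap E F e) = e ^ m := fun e => by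
    rw [Algebra.norm_algebraMap, hn]
  -- it divides a power of `f - 1`
  have hgreg : ∀ V : ValuationSubring F, ContainsRat V → (f : F) ∈ V →
      (g : F) * (f - 1) ^ k ∈ V := by
    intro V hV hfV
    by_cases hVD : V = D.ring
    · subst hVD
      have h1 := hfD.sub RationalPlace.hasValue_one
      rw [sub_self] at h1
      by_cases hf1 : (f : F) - 1 = 0
      · rw [hf1, zero_pow hg.pos.ne', mul_zero]
        exact zero_mem _
      · have h2 : 0 < D.ord (.ofMul (Units.mk0 _ hf1)) :=
          (RationalPlace.HasValue.eq_zero_iff (h := Units.mk0 _ hf1) h1).1 rfl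
        have h3 : ((g * Units.mk0 _ hf1 ^ k : Fˣ) : F) ∈ D.ring := by
          rw [D.mem_ring_iff, ofMul_mul, ofMul_pow, map_add, hg.ord_right, map_nsmul, nsmul_eq_mul]
          nlinarith [(Nat.cast_nonneg k : (0 : ℤ) ≤ k)]
        simpa using h3
    · exact mul_mem (hg.unit V hV (hfB V hfV) hVD).1 (pow_mem (sub_mem hfV (one_mem V)) k)
  have hfA : A.HasValue (f : F) 0 := by
    obtain ⟨q, hq⟩ := RationalPlace.exists_hasValue (p := A) (h := f)
      (by rw [hf.ord_left]; positivity)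
    rwa [hq.eq_zero_iff.2 (by rw [hf.ord_left]; exact_mod_cast hf.pos)] at hq
  obtain ⟨-, b, hb, -⟩ := htA.exists_norm_eq_aeval hτ hgen hgreg
    (hgA.mul ((hfA.sub RationalPlace.hasValue_one).pow k))
  have hab : a * b = (X - C 1) ^ (k * m) := by
    apply transcendental_iff_injective.1 hτtr
    have h1 : ((f : F) - 1) ^ k = algebraMap E F ((τ - 1) ^ k) := by
      rw [map_pow, map_sub, hτ, map_one]
    rw [map_mul, ← ha, ← hb, ← map_mul, Units.inv_mul_cancel_left, h1, hN, ← pow_mul]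
    simp
  obtain ⟨j, -, hj⟩ := (dvd_prime_pow (prime_X_sub_C (1 : ℚ)) _).1 (Dvd.intro _ hab)
  obtain ⟨u, hu⟩ := hj.symm
  obtain ⟨c, hc, hcu⟩ := Polynomial.isUnit_iff.1 u.isUnit
  rw [← hcu] at hu
  have hdeg : a.natDegree = j := by
    rw [← hu, natDegree_mul_C hc.ne_zero, natDegree_pow, natDegree_X_sub_C, mul_one]
  have hlead : a.leadingCoeff = c := by
    rw [← hu, leadingCoeff_mul, leadingCoeff_pow, leadingCoeff_X_sub_C, one_pow, one_mul,
      leadingCoeff_C]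
  have hcj : (-1) ^ j * c = 1 := by
    rw [← hu] at ha0
    simpa using ha0
  -- the norm of `(f ^ k * g ^ m)⁻¹` is a polynomial in `f⁻¹`
  have hv0 : v ≠ 0 := by
    rw [Ne, hv.eq_zero_iff, ofMul_mul, ofMul_pow, ofMul_pow, map_add, map_nsmul, map_nsmul,
      hf.ord_right, hg.ord_left, nsmul_eq_mul, nsmul_eq_mul]
    linarith [mul_comm (k : ℤ) m]
  have hvinv := hv.inv hv0
  obtain ⟨-, r, hr, hr0⟩ := htB.exists_norm_eq_aeval hτ' hgen' (fun V hV hfV => by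
    by_cases hVB : V = B.ring
    · exact hVB ▸ hvinv.1
    · rw [mul_inv, ← inv_pow, ← inv_pow]
      push_cast
      exact mul_mem (pow_mem (by simpa using hfV) k)
        (pow_mem (by simpa using hreg V hV hVB) m)) hvinv
  have hr1 : r.eval 0 ≠ 0 := by
    rw [hr0]
    exact pow_ne_zero _ (inv_ne_zero hv0)
  -- both sides are the norm of `g⁻¹ ^ m`, multiplied by the same power of `f`
  have hpoly : r.reverse * X ^ (m * k) = a ^ m * X ^ r.natDegree := by
    apply transcendental_iff_injective.1 hτtr
    have h1 : aeval τ r.reverse = aeval τ⁻¹ r * τ ^ r.natDegree := by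
      let : Invertible τ⁻¹ := invertibleOfNonzero (inv_ne_zero hτ0)
      have := eval₂_reverse_mul_pow (algebraMap ℚ E) τ⁻¹ r
      rw [invOf_eq_inv, inv_inv, ← aeval_def, ← aeval_def, inv_pow] at this
      rw [← this, inv_mul_cancel_right₀ (pow_ne_zero _ hτ0)]
    rw [map_mul, map_mul, h1, ← hr, map_pow, map_pow, map_pow, ← ha, aeval_X, mul_right_comm]
    congr 1
    rw [mul_comm m, pow_mul, ← hN, ← map_mul, ← map_pow, map_pow, hτ]
    congr 1
    rw [← Units.val_pow_eq_pow_val, ← Units.val_mul, mul_inv, mul_right_comm, inv_mul_cancel,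
      one_mul, ← inv_pow, Units.val_pow_eq_pow_val]
  have hrtr : r.natTrailingDegree = 0 :=
    natTrailingDegree_eq_zero.2 (Or.inr (by rwa [coeff_zero_eq_eval_zero]))
  have hd := congrArg natDegree hpoly
  have hl := congrArg leadingCoeff hpoly
  have ha1 : a ≠ 0 := fun h => by simp [h] at ha0
  rw [leadingCoeff_mul, leadingCoeff_mul, leadingCoeff_X_pow, leadingCoeff_X_pow, mul_one, mul_one,
    leadingCoeff_pow, hlead, reverse_leadingCoeff, trailingCoeff, hrtr, coeff_zero_eq_eval_zero,
    hr0] at hl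
  have hr2 : r ≠ 0 := fun h => hr1 (by rw [h, eval_zero])
  rw [natDegree_mul (by simpa using hr2) (pow_ne_zero _ X_ne_zero),
    natDegree_mul (pow_ne_zero _ ha1) (pow_ne_zero _ X_ne_zero), natDegree_X_pow, natDegree_X_pow,
    reverse_natDegree, hrtr, natDegree_pow, hdeg] at hd
  have hjk : j = k := Nat.eq_of_mul_eq_mul_left hf.pos (by omega)
  rw [hjk] at hcj
  rw [pow_mul, ← inv_inj, ← inv_pow, hl, eq_inv_of_mul_eq_one_right hcj, inv_pow]

/-- The reciprocity law for two functions with divisors `m (A) - m (B)` and `k (B) - k (D)`. -/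
theorem HasDivisor.reciprocity (hf : HasDivisor f A B m) (hg : HasDivisor g B D k)
    (hfD : D.HasValue (f : F) 1) (hgA : A.HasValue (g : F) 1) :
    B.HasValue ((f ^ k * g ^ m : Fˣ) : F) ((-1) ^ (m * k)) := by
  have hord : ∀ a b : ℕ, k * b = m * a → B.ord (.ofMul (f ^ a * g ^ b)) = 0 := fun a b hab => by
    rw [ofMul_mul, ofMul_pow, ofMul_pow, map_add, map_nsmul, map_nsmul, hf.ord_right, hg.ord_left,
      nsmul_eq_mul, nsmul_eq_mul]
    have : (k * b : ℤ) = m * a := by exact_mod_cast hab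
    linarith [mul_comm (k : ℤ) b, mul_comm (m : ℤ) a]
  obtain ⟨v, hv⟩ := RationalPlace.exists_hasValue (p := B) (hord k m (mul_comm k m)).ge
  have h1 := hf.value_pow_eq hg hfD hgA hv
  have hv0 : v ≠ 0 := by
    rw [Ne, hv.eq_zero_iff, hord k m (mul_comm k m)]
    exact lt_irrefl _
  have key : v = (-1) ^ (m * k) := by
    rcases Nat.even_or_odd m with hm | hm
    · rcases Nat.even_or_odd k with hk | hk
      -- for even `m` and `k`, the value `v` is a square, hence positive
      · obtain ⟨a, ha⟩ := hm
        obtain ⟨b, hb⟩ := hk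
        obtain ⟨w, hw⟩ := RationalPlace.exists_hasValue (p := B) (hord b a (by rw [ha, hb]; ring)).ge
        have h2 : v = w ^ 2 := by
          refine hv.unique ?_
          have := hw.pow 2
          rwa [← Units.val_pow_eq_pow_val, mul_pow, ← pow_mul, ← pow_mul, mul_two, mul_two, ← ha,
            ← hb] at this
        rw [Even.neg_one_pow (Even.mul_right ⟨b, hb⟩ m), h2] at h1
        rw [Even.neg_one_pow (Even.mul_left ⟨b, hb⟩ m), h2]
        exact (pow_eq_one_iff_of_nonneg (sq_nonneg w) hf.pos.ne').1 h1
      -- for odd `k`, the roles of `f` and `g` are exchanged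
      · have h3 := hg.inv.value_pow_eq hf.inv hgA.inv_one hfD.inv_one (v := v⁻¹) (by
          have := hv.inv hv0
          rwa [mul_inv, mul_comm, ← inv_pow, ← inv_pow] at this)
        rw [pow_mul] at h3
        have h4 : v⁻¹ = (-1) ^ m := hk.pow_injective h3
        rw [mul_comm, pow_mul, hk.neg_one_pow, ← inv_inv v, h4, ← inv_pow]
        norm_num
    · rw [pow_mul] at h1 ⊢
      rw [hm.neg_one_pow]
      exact hm.pow_injective h1
  rwa [← key]

end Reciprocity

/-! ### Valuation rings and local rings of a curve -/

namespace CurveOverQ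

instance (C : CurveOverQ) : CharZero C.F := charZero_of_injective_ringHom C.const.injective

variable (C : CurveOverQ)

/-- Every valuation ring of the function field that contains `ℚ` is a local ring of the curve: by the
valuative criterion it dominates one, and local rings of a regular curve are valuation rings. -/
theorem exists_localRing_range_eq (V : ValuationSubring C.F) (hV : ∀ q, C.const q ∈ V) :
    ∃ x : C.X, (algebraMap (C.localRing x) C.F).range = V.toSubring := by
  let ι : ℚ →+* V := C.const.codRestrict V.toSubring hV
  let i₁ : Spec (.of C.F) ⟶ C.X := C.X.fromSpecStalk (genericPoint C.X)
  let j : CommRingCat.of V ⟶ CommRingCat.of C.F := CommRingCat.ofHom V.subtype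
  have sq : CommSq i₁ (Spec.map j) C.π (Spec.map (CommRingCat.ofHom ι)) := by
    refine ⟨?_⟩
    obtain ⟨φ, hφ⟩ := Spec.map_surjective (i₁ ≫ C.π)
    refine hφ.symm.trans (Eq.trans ?_ (Spec.map_comp _ _))
    refine congrArg Spec.map ?_
    ext1
    exact RingHom.ext_rat _ _
  have h1 : ValuativeCriterion C.π :=
    ((IsProper.eq_valuativeCriterion ▸ C.isProper : (ValuativeCriterion ⊓ @QuasiCompact ⊓
      @QuasiSeparated ⊓ @LocallyOfFiniteType : MorphismProperty Scheme) C.π)).1.1.1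
  obtain ⟨l, hl, -⟩ := (h1.existence { R := V, K := C.F, commSq := sq, .. }).exists_lift
  change Spec.map j ≫ l = i₁ at hl
  let x : C.X := l (IsLocalRing.closedPoint V)
  let s : C.X.presheaf.stalk x ⟶ CommRingCat.of V := Scheme.stalkClosedPointTo l
  have hs : Spec.map s ≫ C.X.fromSpecStalk x = l := Scheme.Spec_stalkClosedPointTo_fromSpecStalk l
  have hη : genericPoint C.X ⤳ x := genericPoint_specializes x
  let a : C.X.presheaf.stalk x ⟶ CommRingCat.of C.F := C.X.presheaf.stalkSpecializes hη
  have ha : a.hom = algebraMap (C.localRing x) C.F := rfl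
  have h2 : s ≫ j = a := by
    apply Spec.map_injective
    rw [← cancel_mono (C.X.fromSpecStalk x), Spec.map_comp, Category.assoc, hs, hl]
    exact (Scheme.SpecMap_stalkSpecializes_fromSpecStalk hη).symm
  have h3 : ∀ r, (s.hom r : C.F) = algebraMap (C.localRing x) C.F r := fun r => by
    rw [← ha, ← h2]; rfl
  have hloc : IsLocalHom s.hom := Scheme.isLocalHom_stalkClosedPointTo l
  refine ⟨x, le_antisymm ?_ fun v hv => ?_⟩
  · rintro _ ⟨r, rfl⟩
    rw [← h3]
    exact (s.hom r).2
  have := C.isPrincipalIdealRing x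
  have hval : ValuationRing (C.localRing x) := inferInstance
  obtain hr | ⟨r, hr⟩ := ValuationRing.isInteger_or_isInteger (C.localRing x) v
  · exact hr
  by_cases hv0 : v = 0
  · exact hv0 ▸ zero_mem _
  have hu : IsUnit r := by
    refine hloc.1 r (.of_mul_eq_one (⟨v, hv⟩ : V) (Subtype.ext ?_))
    change (s.hom r : C.F) * v = 1
    rw [h3, hr, inv_mul_cancel₀ hv0]
  obtain ⟨u, rfl⟩ := hu
  refine ⟨(u⁻¹ : (C.localRing x)ˣ), ?_⟩
  rw [← inv_inv v, ← hr]
  refine eq_inv_of_mul_eq_one_left ?_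
  rw [← map_mul, Units.inv_mul, map_one]

variable {C}

theorem coheight_ne_one_of_not_isClosed {x : C.X} (hx : ¬ IsClosed ({x} : Set C.X)) :
    Order.coheight x ≠ 1 := by
  intro h1
  have : ∃ y, x ⤳ y ∧ y ≠ x := by
    by_contra! h
    refine hx (isClosed_of_closure_subset fun y hy => ?_)
    exact h y (specializes_iff_mem_closure.2 hy)
  obtain ⟨y, hxy, hne⟩ := this
  have hlt : y < x := lt_of_le_not_ge hxy fun hyx =>
    hne (Specializes.antisymm hyx hxy).eq
  have h2 := Order.coheight_add_one_le hlt
  have h3 := h2.trans (C.coheight_le_one y)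
  rw [h1] at h3
  exact absurd h3 (by decide)

theorem ordAt_eq_zero_of_not_isClosed {x : C.X} (hx : ¬ IsClosed ({x} : Set C.X)) (f : C.Fˣ) :
    C.ordAt x (.ofMul f) = 0 :=
  Scheme.ord_eq_zero_of_coheight_neq_one (coheight_ne_one_of_not_isClosed hx) _

theorem coheight_eq_one_of_isClosed {x : C.X} (hx : IsClosed ({x} : Set C.X)) :
    Order.coheight x = 1 := by
  by_contra h1
  have h0 : Order.coheight x = 0 :=
    Order.lt_one_iff.mp (lt_of_le_of_ne (C.coheight_le_one x) h1)
  have hmax := Order.coheight_eq_zero.1 h0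
  have hη : genericPoint C.X ⤳ x := genericPoint_specializes x
  have hx' : genericPoint C.X = x := (Specializes.antisymm hη (hmax hη)).eq
  have : Subsingleton C.X := by
    refine ⟨fun a b => ?_⟩
    have key : ∀ y : C.X, y = x := fun y => by
      have : x ⤳ y := hx' ▸ genericPoint_specializes y
      have h2 := specializes_iff_mem_closure.1 this
      rwa [hx.closure_eq] at h2
    rw [key a, key b]
  have h2 : Order.krullDim C.X = 1 := by
    rw [← C.dim_eq_one, topologicalKrullDim]
    exact (Order.krullDim_eq_of_orderIso (irreducibleSetEquivPoints (α := C.X))).symm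
  have : Nonempty C.X := ⟨x⟩
  rw [Order.krullDim_eq_zero] at h2
  exact zero_ne_one h2

theorem mem_range_iff (x : C.X) (h : C.Fˣ) :
    (h : C.F) ∈ (algebraMap (C.localRing x) C.F).range ↔ 0 ≤ C.ordAt x (.ofMul h) := by
  have hmem : ∀ f : C.Fˣ, (f : C.F) ∈ (algebraMap (C.localRing x) C.F).range →
      0 ≤ C.ordAt x (.ofMul f) := by
    rintro f ⟨r, hr⟩
    by_cases hx : Order.coheight x = 1
    · have : Ring.KrullDimLE 1 (C.localRing x) := krullDimLE_of_coheight_le hx.le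
      change 0 ≤ Scheme.ord (f : C.F) x
      rw [Scheme.le_ord_iff hx f.ne_zero, ← hr]
      refine Ring.ordFrac_ge_one_of_ne_zero ?_
      rintro rfl
      exact f.ne_zero (by rw [← hr, map_zero])
    · exact (Scheme.ord_eq_zero_of_coheight_neq_one hx _).ge
  refine ⟨hmem h, fun h0 => ?_⟩
  have := C.isPrincipalIdealRing x
  have hval : ValuationRing (C.localRing x) := inferInstance
  obtain hr | hr := ValuationRing.isInteger_or_isInteger (C.localRing x) (h : C.F)
  · exact hr
  · have h1 := hmem h⁻¹ (by rwa [Units.val_inv_eq_inv_val])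
    rw [ofMul_inv, map_neg] at h1
    obtain ⟨u, hu⟩ := C.exists_unit_of_ordAt_eq_zero (x := x) (f := h) (by omega)
    exact ⟨u, by rw [← hu]; rfl⟩

theorem isUnit_iff_ordAt_eq_zero {x : C.X} {r : C.localRing x} {h : C.Fˣ}
    (hr : algebraMap (C.localRing x) C.F r = h) : IsUnit r ↔ C.ordAt x (.ofMul h) = 0 := by
  constructor
  · rintro ⟨u, rfl⟩
    have : h = Units.map (algebraMap (C.localRing x) C.F).toMonoidHom u := Units.ext hr.symm
    rw [this]
    exact C.ordAt_units_map x u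
  · intro h0
    obtain ⟨u, rfl⟩ := C.exists_unit_of_ordAt_eq_zero h0
    rw [IsFractionRing.injective (C.localRing x) C.F hr]
    exact u.isUnit

theorem exists_ordAt_eq_one {x : C.X} (hx : IsClosed ({x} : Set C.X)) :
    ∃ h : C.Fˣ, C.ordAt x (.ofMul h) = 1 := by
  have h1 := coheight_eq_one_of_isClosed hx
  have := C.isDVR h1
  have : Ring.KrullDimLE 1 (C.localRing x) := krullDimLE_of_coheight_le h1.le
  obtain ⟨ϖ, hϖ⟩ := IsDiscreteValuationRing.exists_irreducible (C.localRing x)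
  have h0 : algebraMap (C.localRing x) C.F ϖ ≠ 0 := fun h =>
    hϖ.ne_zero (IsFractionRing.injective (C.localRing x) C.F (by rw [h, map_zero]))
  refine ⟨Units.mk0 _ h0, (Scheme.ord_eq_iff h1 h0).2 ?_⟩
  exact Ring.ordFrac_irreducible hϖ

/-- The valuation subring of the function field given by the local ring at a point. -/
def valuationSubring (x : C.X) : ValuationSubring C.F where
  toSubring := (algebraMap (C.localRing x) C.F).range
  mem_or_inv_mem' h := by
    have := C.isPrincipalIdealRing x
    have hval : ValuationRing (C.localRing x) := inferInstance
    exact ValuationRing.isInteger_or_isInteger (C.localRing x) h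

theorem mem_valuationSubring_iff (x : C.X) (h : C.Fˣ) :
    (h : C.F) ∈ valuationSubring x ↔ 0 ≤ C.ordAt x (.ofMul h) := mem_range_iff x h

theorem exists_valuationSubring_eq {V : ValuationSubring C.F} (hV : ContainsRat V) :
    ∃ x : C.X, V = valuationSubring x := by
  obtain ⟨x, hx⟩ := C.exists_localRing_range_eq V fun q => by
    rw [eq_ratCast C.const]
    exact hV q
  exact ⟨x, ValuationSubring.toSubring_injective hx.symm⟩

theorem ordAt_const (x : C.X) (q : ℚˣ) :
    C.ordAt x (.ofMul (Units.map C.const.toMonoidHom q)) = 0 := by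
  let ι : ℚ →+* C.localRing x :=
    ((Scheme.ΓSpecIso (.of ℚ)).inv ≫ C.π.appTop ≫ C.X.presheaf.germ ⊤ x trivial).hom
  have : Units.map C.const.toMonoidHom q =
      Units.map (algebraMap (C.localRing x) C.F).toMonoidHom (Units.map ι.toMonoidHom q) :=
    Units.ext (congrArg (fun f : ℚ →+* C.F => f q)
      (RingHom.ext_rat C.const ((algebraMap (C.localRing x) C.F).comp ι)))
  rw [this]
  exact C.ordAt_units_map x _

/-- The isomorphism of the local ring at `x` with its image in the function field. -/
def localRingEquiv (x : C.X) : C.localRing x ≃+* valuationSubring x :=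
  RingEquiv.ofBijective (algebraMap (C.localRing x) C.F).rangeRestrict
    ⟨fun _ _ h => IsFractionRing.injective (C.localRing x) C.F (congrArg Subtype.val h),
      (algebraMap (C.localRing x) C.F).rangeRestrict_surjective⟩

/-- A rational point of `C` as a place of the function field. -/
def Point.place (P : C.Point ℚ) : RationalPlace C.F where
  ring := valuationSubring P.center
  ev := P.eval.comp (localRingEquiv P.center).symm.toRingHom
  ord := C.ordAt P.center
  mem_ring_iff := mem_valuationSubring_iff P.center
  ev_eq_zero_iff h hh := by
    obtain ⟨r, hr⟩ := (localRingEquiv P.center).surjective ⟨h, hh⟩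
    have hr' : algebraMap (C.localRing P.center) C.F r = h := congrArg Subtype.val hr
    rw [← hr]
    change P.eval ((localRingEquiv P.center).symm (localRingEquiv P.center r)) = 0 ↔ _
    rw [RingEquiv.symm_apply_apply]
    have h0 := (mem_valuationSubring_iff P.center h).1 hh
    have h1 := isUnit_iff_ordAt_eq_zero hr'
    constructor
    · intro h2
      have : ¬ IsUnit r := fun hu => (hu.map P.eval).ne_zero h2
      rw [h1] at this
      omega
    · intro h2
      exact P.eval_eq_zero (by rw [h1]; omega)
  exists_ord_eq_one := exists_ordAt_eq_one P.isClosed_center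

theorem Point.hasValue_value (P : C.Point ℚ) {f : C.Fˣ} (hf : P.ord f = 0) :
    P.place.HasValue (f : C.F) (P.value f : ℚ) := by
  obtain ⟨u, rfl⟩ := C.exists_unit_of_ordAt_eq_zero hf
  refine ⟨⟨u, rfl⟩, ?_⟩
  rw [P.value_units_map]
  have : (⟨_, ⟨u, rfl⟩⟩ : valuationSubring P.center) = localRingEquiv P.center u := rfl
  change P.eval ((localRingEquiv P.center).symm (localRingEquiv P.center u)) = _
  rw [RingEquiv.symm_apply_apply]
  rfl

/-- Both homomorphisms have the maximal ideal as kernel, and the residue field is `ℚ`. -/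
theorem map_eq_ratCast_of_isLocalHom {R K : Type*} [CommRing R] [Field K] [CharZero K]
    (φ : R →+* ℚ) (ψ : R →+* K) [IsLocalHom φ] [IsLocalHom ψ] (r : R) : ψ r = (φ r : K) := by
  have h1 : φ ((φ r).den * r - (φ r).num) = 0 := by
    rw [map_sub, map_mul, map_natCast, map_intCast, mul_comm, Rat.mul_den_eq_num, sub_self]
  have h2 : ψ ((φ r).den * r - (φ r).num) = 0 := by
    by_contra h
    have := (isUnit_of_map_unit ψ _ (isUnit_iff_ne_zero.2 h)).map φ
    rw [h1] at this
    exact not_isUnit_zero this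
  rw [map_sub, map_mul, map_natCast, map_intCast, sub_eq_zero] at h2
  have h3 : ((φ r).den : K) ≠ 0 := by exact_mod_cast (φ r).den_nz
  rw [Rat.cast_def, ← h2, mul_div_cancel_left₀ _ h3]

section Value
variable {K : Type} [Field K] [Algebra ℚ K]

/-- A point with centre `x` as a local homomorphism on the local ring at `x`; the equation `p.center =
x` is a hypothesis so that two points with the same centre can be compared. -/
theorem Point.exists_localHom (p : C.Point K) {x : C.X} (hx : p.center = x) :
    ∃ φ : C.X.presheaf.stalk x ⟶ .of K, IsLocalHom φ.hom ∧
      p.hom = Spec.map φ ≫ C.X.fromSpecStalk x ∧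
      ∀ u : (C.localRing x)ˣ,
        (p.value (Units.map (algebraMap (C.localRing x) C.F).toMonoidHom u) : K) = φ.hom u := by
  subst hx
  refine ⟨Scheme.stalkClosedPointTo p.hom, Scheme.isLocalHom_stalkClosedPointTo' p.hom,
    (Scheme.Spec_stalkClosedPointTo_fromSpecStalk p.hom).symm, fun u => ?_⟩
  rw [p.value_units_map]
  rfl

/-- The value of a function at a geometric point above a rational point `P` is its value at `P`. -/
theorem Point.value_eq_ratCast (p : C.Point K) (P : C.Point ℚ) (h : p.center = P.center)
    {f : C.Fˣ} (hf : P.ord f = 0) : (p.value f : K) = ((P.value f : ℚ) : K) := by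
  have : CharZero K := charZero_of_injective_algebraMap (algebraMap ℚ K).injective
  obtain ⟨φ, hφ, -, hφv⟩ := p.exists_localHom h
  obtain ⟨ψ, hψ, -, hψv⟩ := P.exists_localHom rfl
  obtain ⟨u, rfl⟩ := C.exists_unit_of_ordAt_eq_zero hf
  rw [hφv, hψv]
  exact map_eq_ratCast_of_isLocalHom ψ.hom φ.hom u

end Value

theorem Point.center_injective : Function.Injective (Point.center : C.Point ℚ → C.X) := by
  intro P Q h
  obtain ⟨φ, hφ, hP, -⟩ := P.exists_localHom h
  obtain ⟨ψ, hψ, hQ, -⟩ := Q.exists_localHom rfl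
  have : φ = ψ := by
    ext r
    exact (map_eq_ratCast_of_isLocalHom ψ.hom φ.hom r).trans (Rat.cast_id _)
  have h1 : P.hom = Q.hom := by rw [hP, hQ, this]
  cases P; cases Q
  simpa using h1

open Classical in
theorem IsDivisorOf.ordAt_eq {P Q : C.Point ℚ} {m : ℕ} {f : C.Fˣ}
    (hf : IsDivisorOf (m • P.toDiv - m • Q.toDiv) f) (x : C.X) : C.ordAt x (.ofMul f) =
      m * ((if P.center = x then 1 else 0) - if Q.center = x then 1 else 0) := by
  by_cases hx : IsClosed ({x} : Set C.X)
  · have := hf ⟨x, hx⟩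
    simp [Point.toDiv, Finsupp.single_apply, Point.toClosedPoint, Subtype.ext_iff] at this
    rw [← this]
    split_ifs <;> simp
  · rw [ordAt_eq_zero_of_not_isClosed hx, if_neg, if_neg, sub_zero, mul_zero]
    · rintro rfl; exact hx Q.isClosed_center
    · rintro rfl; exact hx P.isClosed_center

theorem IsDivisorOf.hasDivisor {P Q : C.Point ℚ} (hPQ : P ≠ Q) {m : ℕ} (hm : 0 < m) {f : C.Fˣ}
    (hf : IsDivisorOf (m • P.toDiv - m • Q.toDiv) f) : HasDivisor f P.place Q.place m := by
  have hne : P.center ≠ Q.center := fun h => hPQ (Point.center_injective h)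
  refine ⟨hm, ?_, ?_, fun V hV hVP hVQ => ?_⟩
  · refine (hf.ordAt_eq P.center).trans ?_
    rw [if_pos rfl, if_neg hne.symm, sub_zero, mul_one]
  · refine (hf.ordAt_eq Q.center).trans ?_
    rw [if_neg hne, if_pos rfl, zero_sub, mul_neg, mul_one]
  · obtain ⟨x, rfl⟩ := exists_valuationSubring_eq hV
    have h0 := hf.ordAt_eq x
    rw [if_neg (by rintro rfl; exact hVP rfl), if_neg (by rintro rfl; exact hVQ rfl), sub_zero,
      mul_zero] at h0
    rw [mem_valuationSubring_iff, mem_valuationSubring_iff, ofMul_inv, map_neg, h0]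
    simp

end CurveOverQ

/-! ### Symbols in `K₂` -/

namespace K2

variable {F : Type*} [Field F]

theorem symbol_mul_left (a b c : Fˣ) : symbol (a * b) c = symbol a c + symbol b c := by
  simp only [symbol, ofMul_mul, TensorProduct.add_tmul, QuotientAddGroup.mk_add]

theorem symbol_mul_right (a b c : Fˣ) : symbol a (b * c) = symbol a b + symbol a c := by
  simp only [symbol, ofMul_mul, TensorProduct.tmul_add, QuotientAddGroup.mk_add]

/-- The symbol `{a, ·}` as a homomorphism. -/
def symbolHom (a : Fˣ) : Additive Fˣ →+ K2 F :=
  AddMonoidHom.mk' (fun b => symbol a b.toMul) fun b c => symbol_mul_right a b.toMul c.toMul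

theorem symbol_one_right (a : Fˣ) : symbol a 1 = 0 := map_zero (symbolHom a)

theorem symbol_inv_right (a b : Fˣ) : symbol a b⁻¹ = -symbol a b :=
  map_neg (symbolHom a) (.ofMul b)

theorem symbol_pow_right (a b : Fˣ) (n : ℕ) : symbol a (b ^ n) = n • symbol a b :=
  map_nsmul (symbolHom a) n (.ofMul b)

theorem symbol_prod_right {ι : Type*} (s : Finset ι) (a : Fˣ) (b : ι → Fˣ) :
    symbol a (∏ i ∈ s, b i) = ∑ i ∈ s, symbol a (b i) :=
  map_sum (symbolHom a) (fun i => Additive.ofMul (b i)) s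

theorem symbol_inv_left (a b : Fˣ) : symbol a⁻¹ b = -symbol a b := by
  refine eq_neg_of_add_eq_zero_left ?_
  rw [← symbol_mul_left, inv_mul_cancel]
  simp [symbol]

theorem symbol_eq_zero {a b : Fˣ} (h : (b : F) = 1 - a) : symbol a b = 0 :=
  (QuotientAddGroup.eq_zero_iff _).2 (AddSubgroup.subset_closure ⟨a, b, h, rfl⟩)

/-- The equation follows from the Steinberg relations for `a` and `a⁻¹`, as
`-a = (1 - a) / (1 - a⁻¹)`. -/
theorem symbol_neg_self (a : Fˣ) : symbol a (-a) = 0 := by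
  by_cases ha : (a : F) = 1
  · have : a = 1 := Units.ext ha
    rw [this]
    simp [symbol]
  have ha' : (1 : F) - a ≠ 0 := sub_ne_zero.2 (Ne.symm ha)
  have ha'' : (1 : F) - (a⁻¹ : Fˣ) ≠ 0 := by
    rw [sub_ne_zero, Units.val_inv_eq_inv_val]
    exact fun h => ha (inv_eq_one.1 h.symm)
  have h : -a = Units.mk0 _ ha' * (Units.mk0 _ ha'')⁻¹ := by
    rw [eq_mul_inv_iff_mul_eq]
    refine Units.ext ?_
    push_cast
    simp only [Units.val_mk0]
    field_simp
    ring
  rw [h, symbol_mul_right, symbol_inv_right, symbol_eq_zero rfl, zero_add, ← symbol_inv_left,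
    symbol_eq_zero rfl]

theorem symbol_swap (a b : Fˣ) : symbol a b = -symbol b a := by
  have h := symbol_neg_self (a * b)
  have h1 : symbol a (-(a * b)) = symbol a b := by
    rw [neg_mul_eq_neg_mul, symbol_mul_right, symbol_neg_self, zero_add]
  have h2 : symbol b (-(a * b)) = symbol b a := by
    rw [neg_mul_eq_mul_neg, symbol_mul_right, symbol_neg_self, add_zero]
  rw [symbol_mul_left, h1, h2] at h
  exact eq_neg_of_add_eq_zero_left h

theorem two_nsmul_symbol_self (a : Fˣ) : 2 • symbol a a = 0 := by
  rw [two_nsmul]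
  exact eq_neg_iff_add_eq_zero.1 (symbol_swap a a)

end K2

/-! ### Common divisors in a torsion-free group -/

/-- If the integers `a i` have no common divisor, then elements `s i` of a torsion-free group with
`a i • s j = a j • s i` are the multiples `a i • T` of a unique element `T`. -/
theorem existsUnique_eq_smul_of_smul_comm {ι M : Type*} [Nonempty ι] [AddCommGroup M]
    [IsAddTorsionFree M] (a : ι → ℕ) (ha : ∀ i, a i ≠ 0) (hgcd : ∀ d, (∀ i, d ∣ a i) → d = 1)
    (s : ι → M) (hs : ∀ i j, a i • s j = a j • s i) : ∃! T : M, ∀ i, s i = a i • T := by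
  -- the integers `n` for which all `n • s j` have the form `a j • T` are an ideal
  let I : Ideal ℤ :=
    { carrier := {n | ∃ T : M, ∀ j, n • s j = a j • T}
      zero_mem' := ⟨0, by simp⟩
      add_mem' := by
        rintro n k ⟨T, hT⟩ ⟨U, hU⟩
        exact ⟨T + U, fun j => by rw [add_smul, hT, hU, smul_add]⟩
      smul_mem' := by
        rintro c n ⟨T, hT⟩
        exact ⟨c • T, fun j => by rw [smul_eq_mul, mul_smul, hT, smul_comm]⟩ }
  have hI : (1 : ℤ) ∈ I := by
    obtain ⟨d, hd⟩ := IsPrincipalIdealRing.principal I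
    have h1 : ∀ i, d ∣ a i := fun i => by
      rw [← Ideal.mem_span_singleton, ← Ideal.submodule_span_eq, ← hd]
      exact ⟨s i, fun j => by rw [natCast_zsmul, hs]⟩
    have h2 : d.natAbs = 1 := hgcd _ fun i => Int.natAbs_dvd_natAbs.2 (h1 i)
    rw [hd, Ideal.submodule_span_eq, Ideal.mem_span_singleton]
    exact (Int.isUnit_iff_natAbs_eq.2 h2).dvd
  obtain ⟨T, hT⟩ := hI
  refine ⟨T, fun i => by rw [← hT, one_smul], fun U hU => ?_⟩
  obtain ⟨i⟩ := ‹Nonempty ι›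
  refine nsmul_right_injective (ha i) ?_
  change a i • U = a i • T
  rw [← hU i, ← hT, one_smul]

/-! ### Tame symbols -/

namespace CurveOverQ

variable {C : CurveOverQ}

theorem Point.hasValue_normalize (P : C.Point ℚ) {f : C.Fˣ} (hf : P.ord f = 0) :
    P.place.HasValue (P.normalize f : C.F) 1 := by
  have h1 := P.hasValue_value hf
  let c := Units.map C.const.toMonoidHom (P.value f)
  have h2 : P.place.HasValue (c : C.F) (P.value f : ℚ) := by
    have h3 : ((P.value f : ℚ) : C.F) = c := (eq_ratCast C.const _).symm
    refine ⟨h3 ▸ P.place.ratCast_mem _, ?_⟩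
    have h4 : (P.place.ev.comp ((Rat.castHom C.F).codRestrict P.place.ring.toSubring
        P.place.ratCast_mem)) = RingHom.id ℚ := RingHom.ext_rat _ _
    have h5 := congrArg (fun φ => φ (P.value f : ℚ)) h4
    exact (congrArg P.place.ev (Subtype.ext h3.symm)).trans h5
  have h6 := h1.mul (h2.inv (P.value f).ne_zero)
  rwa [mul_inv_cancel₀ (P.value f).ne_zero, ← Units.val_mul, ← div_eq_mul_inv] at h6

theorem ordAt_normalize (P : C.Point ℚ) (f : C.Fˣ) (x : C.X) :
    C.ordAt x (.ofMul (P.normalize f)) = C.ordAt x (.ofMul f) := by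
  rw [Point.normalize, ofMul_div, map_sub, ordAt_const, sub_zero]

theorem IsDivisorOf.normalize {D : C.Div} {f : C.Fˣ} (hf : IsDivisorOf D f) (P : C.Point ℚ) :
    IsDivisorOf D (P.normalize f) := fun x => by rw [ordAt_normalize, hf x]

theorem Point.tame_eq_one_of_hasValue {K : Type} [Field K] [Algebra ℚ K] (p : C.Point K)
    (P : C.Point ℚ) (h : p.center = P.center) {a b : C.Fˣ}
    (hab : P.place.HasValue (P.tameFun a b : C.F) 1) : p.tame a b = 1 := by
  have h1 : p.tameFun a b = P.tameFun a b := by simp only [Point.tameFun, Point.ord, h]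
  refine Units.ext ?_
  rw [Point.tame, h1, p.value_eq_ratCast P h (P.ord_tameFun a b),
    (P.hasValue_value (P.ord_tameFun a b)).unique hab]
  simp

/-- At the centres of `P` and `R` one of the two functions is a unit with value `1`, at the centre of
`Q` this is the reciprocity law, and everywhere else both functions are units. -/
theorem tame_eq_one {K : Type} [Field K] [Algebra ℚ K] {P Q R : C.Point ℚ} (hPQ : P ≠ Q)
    (hQR : Q ≠ R) (hPR : P ≠ R) {m k : ℕ} (hm : 0 < m) (hk : 0 < k) {a b : C.Fˣ}
    (ha : IsDivisorOf (m • P.toDiv - m • Q.toDiv) a)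
    (hb : IsDivisorOf (k • Q.toDiv - k • R.toDiv) b)
    (haR : R.place.HasValue (a : C.F) 1) (hbP : P.place.HasValue (b : C.F) 1) (p : C.Point K) :
    p.tame a b = 1 := by
  have ha' := ha.hasDivisor hPQ hm
  have hb' := hb.hasDivisor hQR hk
  have haR0 : R.ord a = 0 := by
    rw [Point.ord, ha.ordAt_eq, if_neg (Point.center_injective.ne hPR),
      if_neg (Point.center_injective.ne hQR), sub_zero, mul_zero]
  have hbP0 : P.ord b = 0 := by
    rw [Point.ord, hb.ordAt_eq, if_neg (Point.center_injective.ne hPQ.symm),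
      if_neg (Point.center_injective.ne hPR.symm), sub_zero, mul_zero]
  by_cases h1 : p.center = P.center
  · refine p.tame_eq_one_of_hasValue P h1 ?_
    have h2 : P.tameFun a b = (b ^ m)⁻¹ := by
      have : P.ord a = m := ha'.ord_left
      simp [Point.tameFun, hbP0, this]
    rw [h2]
    have := hbP.pow m
    rw [one_pow, ← Units.val_pow_eq_pow_val] at this
    exact this.inv_one
  by_cases h2 : p.center = R.center
  · refine p.tame_eq_one_of_hasValue R h2 ?_
    have h3 : R.tameFun a b = (a ^ k)⁻¹ := by
      have : R.ord b = -k := hb'.ord_right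
      simp [Point.tameFun, haR0, this]
    rw [h3]
    have := haR.pow k
    rw [one_pow, ← Units.val_pow_eq_pow_val] at this
    exact this.inv_one
  by_cases h3 : p.center = Q.center
  · refine p.tame_eq_one_of_hasValue Q h3 ?_
    have hQa : Q.ord a = -m := ha'.ord_right
    have hQb : Q.ord b = k := hb'.ord_left
    have h4 : Q.tameFun a b = ((-1) ^ (m * k))⁻¹ * (a ^ k * b ^ m) := by
      rw [Point.tameFun, hQa, hQb, neg_mul, zpow_neg, zpow_neg, div_inv_eq_mul]
      norm_cast
    have h5 : Q.place.HasValue (-1 : C.F) (-1) := by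
      simpa using (RationalPlace.hasValue_one.sub (p := Q.place)
        RationalPlace.hasValue_one).sub RationalPlace.hasValue_one
    have h6 := (h5.pow (m * k))
    have h7 : (-1 : C.F) ^ (m * k) = (((-1) ^ (m * k) : C.Fˣ) : C.F) := by push_cast; rfl
    rw [h7] at h6
    have h8 := (h6.inv (pow_ne_zero _ (by norm_num))).mul (ha'.reciprocity hb' haR hbP)
    rwa [inv_mul_cancel₀ (pow_ne_zero _ (by norm_num)), ← Units.val_mul, ← h4] at h8
  · have hpa : p.ord a = 0 := by
      rw [Point.ord, ha.ordAt_eq, if_neg (Ne.symm h1), if_neg (Ne.symm h3), sub_zero, mul_zero]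
    have hpb : p.ord b = 0 := by
      rw [Point.ord, hb.ordAt_eq, if_neg (Ne.symm h3), if_neg (Ne.symm h2), sub_zero, mul_zero]
    have h4 := p.value_units_map 1
    rw [map_one, map_one] at h4
    rw [Point.tame, Point.tameFun, hpa, hpb]
    simpa using h4

theorem symbol_mem_K2T {a b : C.Fˣ}
    (h : ∀ p : C.Point (AlgebraicClosure ℚ), p.tame a b = 1) : K2.symbol a b ∈ C.K2T := by
  refine (AddSubgroup.mem_iInf).2 fun p => ?_
  rw [AddMonoidHom.mem_ker]
  change Additive.ofMul (p.tame a b) = 0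
  rw [h p]
  rfl

/-- A function with divisor zero and value `1` at one rational point is `1`. -/
theorem eq_one_of_ordAt_eq_zero {u : C.Fˣ} (hu : ∀ x, C.ordAt x (.ofMul u) = 0) {P : C.Point ℚ}
    (hP : P.place.HasValue (u : C.F) 1) : u = 1 := by
  refine Units.ext (hP.eq_one_of_forall_mem fun V hV => ?_)
  obtain ⟨x, rfl⟩ := exists_valuationSubring_eq hV
  rw [mem_valuationSubring_iff, hu]

/-! ### The triple symbol and its symmetries -/

variable {P : ZMod 3 → C.Point ℚ} {f : ZMod 3 → C.Fˣ}

theorem exists_isTripleFunctions (P : ZMod 3 → C.Point ℚ) :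
    ∃ f : ZMod 3 → C.Fˣ, IsTripleFunctions P f := by
  have h : ∀ i, ∃ f : C.Fˣ, IsDivisorOf
      (tripleOrder P i • (P (i + 1)).toDiv - tripleOrder P i • (P (i - 1)).toDiv) f := by
    intro i
    have h1 := addOrderOf_nsmul_eq_zero ((P (i + 1)).diffClass (P (i - 1)))
    have h2 := congrArg Subtype.val h1
    rw [← smul_sub]
    exact (QuotientAddGroup.eq_zero_iff (N := C.principal) _).1 h2
  choose f hf using h
  exact ⟨f, hf⟩

variable (P f) in
/-- The functions `fᵢ / fᵢ(Pᵢ)`. -/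
def normalized (i : ZMod 3) : C.Fˣ := (P i).normalize (f i)

theorem zmod_three_ne (i : ZMod 3) : i + 1 ≠ i ∧ i - 1 ≠ i ∧ i + 1 ≠ i - 1 := by
  revert i; decide

theorem zmod_three_add_sub (i : ZMod 3) : i + 1 + 1 = i - 1 ∧ i - 1 - 1 = i + 1 := by
  revert i; decide

theorem IsTripleFunctions.isDivisorOf_normalized (hf : IsTripleFunctions P f) (i : ZMod 3) :
    IsDivisorOf (tripleOrder P i • (P (i + 1)).toDiv - tripleOrder P i • (P (i - 1)).toDiv)
      (normalized P f i) := (hf i).normalize _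

theorem IsTripleFunctions.hasValue_normalized (hdist : Function.Injective P)
    (hf : IsTripleFunctions P f) (i : ZMod 3) :
    (P i).place.HasValue (normalized P f i : C.F) 1 := by
  refine (P i).hasValue_normalize ?_
  obtain ⟨h1, h2, -⟩ := zmod_three_ne i
  rw [Point.ord, (hf i).ordAt_eq, if_neg fun h => h1 (hdist (Point.center_injective h)),
    if_neg fun h => h2 (hdist (Point.center_injective h)), sub_zero, mul_zero]

theorem tripleOrder_pos (htors : ∀ i j, IsOfFinAddOrder ((P i).diffClass (P j))) (i : ZMod 3) :
    0 < tripleOrder P i := addOrderOf_pos_iff.2 (htors _ _)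

theorem IsTripleFunctions.tripleS_mem (hdist : Function.Injective P)
    (htors : ∀ i j, IsOfFinAddOrder ((P i).diffClass (P j))) (hf : IsTripleFunctions P f)
    (i : ZMod 3) : tripleS P f i ∈ C.K2T := by
  obtain ⟨h1, h2, h3⟩ := zmod_three_ne i
  have ha := hf.isDivisorOf_normalized (i + 1)
  have hb := hf.isDivisorOf_normalized (i - 1)
  rw [(zmod_three_add_sub i).1, add_sub_cancel_right] at ha
  rw [sub_add_cancel, (zmod_three_add_sub i).2] at hb
  exact symbol_mem_K2T (tame_eq_one (hdist.ne h2) (hdist.ne h1.symm) (hdist.ne h3.symm)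
    (tripleOrder_pos htors _) (tripleOrder_pos htors _) ha hb
    (hf.hasValue_normalized hdist (i + 1)) (hf.hasValue_normalized hdist (i - 1)))

/-- `lcm(m₁, m₂, m₃)`. -/
def tripleLcm (P : ZMod 3 → C.Point ℚ) : ℕ :=
  Nat.lcm (tripleOrder P 1) (Nat.lcm (tripleOrder P 2) (tripleOrder P 3))

theorem tripleLcm_dvd_iff {n : ℕ} : tripleLcm P ∣ n ↔ ∀ i, tripleOrder P i ∣ n := by
  rw [tripleLcm, Nat.lcm_dvd_iff, Nat.lcm_dvd_iff]
  constructor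
  · rintro ⟨h1, h2, h3⟩ i
    fin_cases i
    exacts [h3, h1, h2]
  · exact fun h => ⟨h 1, h 2, h 3⟩

theorem tripleRatio_mul (i : ZMod 3) : tripleRatio P i * tripleOrder P i = tripleLcm P :=
  Nat.div_mul_cancel (tripleLcm_dvd_iff.1 dvd_rfl i)

theorem tripleLcm_pos (htors : ∀ i j, IsOfFinAddOrder ((P i).diffClass (P j))) :
    0 < tripleLcm P :=
  Nat.lcm_pos (tripleOrder_pos htors _) (Nat.lcm_pos (tripleOrder_pos htors _)
    (tripleOrder_pos htors _))

theorem tripleRatio_ne_zero (htors : ∀ i j, IsOfFinAddOrder ((P i).diffClass (P j)))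
    (i : ZMod 3) : tripleRatio P i ≠ 0 := fun h => by
  have h1 := tripleRatio_mul (P := P) i
  rw [h, zero_mul] at h1
  exact (tripleLcm_pos htors).ne h1

/-- The quotients `lcm(m₁, m₂, m₃) / mᵢ` have no common divisor. -/
theorem eq_one_of_forall_dvd_tripleRatio
    (htors : ∀ i j, IsOfFinAddOrder ((P i).diffClass (P j))) {d : ℕ}
    (hd : ∀ i, d ∣ tripleRatio P i) : d = 1 := by
  have h0 := tripleLcm_pos htors
  have hdl : d ∣ tripleLcm P := (hd 0).trans (Dvd.intro _ (tripleRatio_mul 0))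
  obtain ⟨l, hl⟩ := hdl
  have h1 : tripleLcm P ∣ l := tripleLcm_dvd_iff.2 fun i => by
    obtain ⟨c, hc⟩ := hd i
    have h2 := tripleRatio_mul (P := P) i
    rw [hc, hl, mul_assoc] at h2
    have hd0 : 0 < d := Nat.pos_of_ne_zero (by rintro rfl; simp [hl] at h0)
    exact ⟨c, by rw [mul_comm]; exact (Nat.eq_of_mul_eq_mul_left hd0 h2).symm⟩
  have hl0 : 0 < l := Nat.pos_of_ne_zero (by rintro rfl; simp [hl] at h0)
  rw [hl] at h1
  have h3 := Nat.le_of_dvd hl0 h1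
  have hd0 : 0 < d := Nat.pos_of_ne_zero (by rintro rfl; simp [hl] at h0)
  nlinarith

/-- The product of the functions `φᵢ ^ (lcm(m₁, m₂, m₃) / mᵢ)`, where `φᵢ = fᵢ / fᵢ(Pᵢ)`, has
divisor zero, and its value is a root of unity by the reciprocity law. -/
theorem IsTripleFunctions.exists_pow_prod_eq_one (hdist : Function.Injective P)
    (htors : ∀ i j, IsOfFinAddOrder ((P i).diffClass (P j))) (hf : IsTripleFunctions P f) :
    ∃ N : ℕ, 0 < N ∧ (∏ i, normalized P f i ^ tripleRatio P i) ^ N = 1 := by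
  let φ := normalized P f
  let m := tripleOrder P
  let a := tripleRatio P
  have ham : ∀ i, a i * m i = tripleLcm P := tripleRatio_mul
  have hd1 : IsDivisorOf (m 1 • (P 2).toDiv - m 1 • (P 0).toDiv) (φ 1) :=
    hf.isDivisorOf_normalized 1
  have hd2 : IsDivisorOf (m 2 • (P 0).toDiv - m 2 • (P 1).toDiv) (φ 2) :=
    hf.isDivisorOf_normalized 2
  have hrec := (hd1.hasDivisor (hdist.ne (by decide)) (tripleOrder_pos htors 1)).reciprocity
    (hd2.hasDivisor (hdist.ne (by decide)) (tripleOrder_pos htors 2))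
    (hf.hasValue_normalized hdist 1) (hf.hasValue_normalized hdist 2)
  -- `φ₁ ^ m₂ * φ₂ ^ m₁` has value `±1` at `P₀`; the factor `2` removes the sign
  refine ⟨m 1 * 2, Nat.mul_pos (tripleOrder_pos htors 1) two_pos, ?_⟩
  refine eq_one_of_ordAt_eq_zero (P := P 0) (fun x => ?_) ?_
  · classical
    rw [ofMul_pow, map_nsmul, ofMul_prod, map_sum]
    let δ : ZMod 3 → ℤ := fun i => if (P i).center = x then 1 else 0
    have h1 : ∀ i, C.ordAt x (.ofMul (φ i ^ a i)) = tripleLcm P * (δ (i + 1) - δ (i - 1)) := by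
      intro i
      rw [ofMul_pow, map_nsmul, (hf.isDivisorOf_normalized i).ordAt_eq, ← ham i, nsmul_eq_mul]
      push_cast
      rw [mul_assoc]
    have h2 : ∑ i, δ (i + 1) = ∑ i, δ i := Equiv.sum_comp (Equiv.addRight 1) δ
    have h3 : ∑ i, δ (i - 1) = ∑ i, δ i := Equiv.sum_comp (Equiv.subRight 1) δ
    rw [Finset.sum_congr rfl fun i _ => h1 i, ← Finset.mul_sum, Finset.sum_sub_distrib, h2, h3,
      sub_self, mul_zero, smul_zero]
  · have h2 : (∏ i, φ i ^ a i) ^ (m 1 * 2) =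
        (φ 0 ^ a 0) ^ (m 1 * 2) * ((φ 1 ^ m 2 * φ 2 ^ m 1) ^ a 2) ^ 2 := by
      have h3 : ∏ i, φ i ^ a i = φ 0 ^ a 0 * φ 1 ^ a 1 * φ 2 ^ a 2 :=
        Fin.prod_univ_three (fun i : Fin 3 => φ i ^ a i)
      have h4 : a 1 * m 1 = m 2 * a 2 := by rw [ham, mul_comm, ham]
      rw [h3, mul_assoc, mul_pow (φ 0 ^ a 0), pow_mul (φ 1 ^ a 1 * φ 2 ^ a 2)]
      congr 2
      rw [mul_pow, mul_pow, ← pow_mul, ← pow_mul, ← pow_mul, ← pow_mul, h4, mul_comm (a 2)]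
    have h5 := (((hf.hasValue_normalized hdist 0).pow (a 0)).pow (m 1 * 2)).mul
      ((hrec.pow (a 2)).pow 2)
    have h6 : (((-1 : ℚ) ^ (m 1 * m 2)) ^ a 2) ^ 2 = 1 := by
      rw [← pow_mul, ← pow_mul]
      exact Even.neg_one_pow (Even.mul_left (Even.mul_left even_two _) _)
    rw [one_pow, one_pow, one_mul, h6] at h5
    change (P 0).place.HasValue (((∏ i, φ i ^ a i) ^ (m 1 * 2) : C.Fˣ) : C.F) 1
    rw [h2]
    push_cast
    push_cast at h5
    exact h5

/-- The relation `aᵢ₊₁ Sᵢ₋₁ = aᵢ₋₁ Sᵢ₊₁` modulo torsion, with `aᵢ = lcm(m₁, m₂, m₃) / mᵢ`. It comes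
from the symbol of `φᵢ = fᵢ / fᵢ(Pᵢ)` with the root of unity `∏ φⱼ ^ aⱼ`. -/
theorem IsTripleFunctions.exists_nsmul_symbol_eq_zero (hdist : Function.Injective P)
    (htors : ∀ i j, IsOfFinAddOrder ((P i).diffClass (P j))) (hf : IsTripleFunctions P f) :
    ∃ N : ℕ, 0 < N ∧ ∀ i, N • (tripleRatio P (i + 1) • tripleS P f (i - 1) -
      tripleRatio P (i - 1) • tripleS P f (i + 1)) = 0 := by
  obtain ⟨N, hN, h⟩ := hf.exists_pow_prod_eq_one hdist htors
  refine ⟨2 * N, Nat.mul_pos two_pos hN, fun i => ?_⟩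
  obtain ⟨h1, h2⟩ := zmod_three_add_sub i
  have hS1 : tripleS P f (i - 1) = K2.symbol (normalized P f i) (normalized P f (i + 1)) := by
    rw [tripleS, sub_add_cancel, h2]
    rfl
  have hS2 : tripleS P f (i + 1) = -K2.symbol (normalized P f i) (normalized P f (i - 1)) := by
    rw [← K2.symbol_swap, tripleS, h1, add_sub_cancel_right]
    rfl
  have hsum : ∀ g : ZMod 3 → K2 C.F, ∑ j, g j = g i + g (i + 1) + g (i - 1) := by
    intro g
    rw [← Equiv.sum_comp (Equiv.addLeft i) g]
    refine (Fin.sum_univ_three (fun j : ZMod 3 => g (i + j))).trans ?_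
    rw [sub_eq_add_neg]
    exact congrArg₂ _ (congrArg₂ _ (congrArg g (add_zero i)) rfl) rfl
  have h3 := congrArg (K2.symbol (normalized P f i)) h
  rw [K2.symbol_one_right, K2.symbol_pow_right, K2.symbol_prod_right, hsum, K2.symbol_pow_right,
    K2.symbol_pow_right, K2.symbol_pow_right] at h3
  rw [hS1, hS2, smul_neg, sub_neg_eq_add]
  have h4 := congrArg (2 • ·) h3
  simp only [smul_zero, smul_add] at h4
  rw [smul_comm 2 N (tripleRatio P i • _), smul_comm 2 (tripleRatio P i),
    K2.two_nsmul_symbol_self, smul_zero, smul_zero, zero_add, ← smul_add, ← smul_add,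
    smul_smul] at h4
  exact h4

theorem IsTripleFunctions.existsUnique_isTripleElement (hdist : Function.Injective P)
    (htors : ∀ i j, IsOfFinAddOrder ((P i).diffClass (P j))) (hf : IsTripleFunctions P f) :
    ∃! T : C.K2TModTorsion, IsTripleElement P f T := by
  have hS := hf.tripleS_mem hdist htors
  let s : ZMod 3 → C.K2TModTorsion := fun i => QuotientAddGroup.mk (⟨tripleS P f i, hS i⟩ : C.K2T)
  obtain ⟨N, hN, h⟩ := hf.exists_nsmul_symbol_eq_zero hdist htors
  have hs : ∀ i, tripleRatio P (i + 1) • s (i - 1) = tripleRatio P (i - 1) • s (i + 1) := by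
    intro i
    rw [← sub_eq_zero]
    refine (QuotientAddGroup.eq_zero_iff (N := AddCommGroup.torsion C.K2T)
      (tripleRatio P (i + 1) • (⟨_, hS (i - 1)⟩ : C.K2T) -
        tripleRatio P (i - 1) • (⟨_, hS (i + 1)⟩ : C.K2T))).2 ?_
    exact isOfFinAddOrder_iff_nsmul_eq_zero.2 ⟨N, hN, Subtype.ext (h i)⟩
  have hcases : ∀ i j : ZMod 3, i = j ∨ ∃ k, (i = k + 1 ∧ j = k - 1) ∨ (i = k - 1 ∧ j = k + 1) := by
    decide
  have key := existsUnique_eq_smul_of_smul_comm (tripleRatio P) (tripleRatio_ne_zero htors)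
    (fun d hd => eq_one_of_forall_dvd_tripleRatio htors hd) s fun i j => by
      rcases hcases i j with rfl | ⟨k, ⟨rfl, rfl⟩ | ⟨rfl, rfl⟩⟩
      · rfl
      · exact hs k
      · exact (hs k).symm
  refine (existsUnique_congr fun T => ?_).2 key
  exact ⟨fun ⟨_, h⟩ => h, fun h => ⟨hS, h⟩⟩

theorem Point.diffClass_swap (P Q : C.Point ℚ) : P.diffClass Q = -Q.diffClass P := by
  refine Subtype.ext ?_
  change QuotientAddGroup.mk' C.principal (P.toDiv - Q.toDiv) =
    -QuotientAddGroup.mk' C.principal (Q.toDiv - P.toDiv)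
  rw [← map_neg, neg_sub]

/-- Even permutations of `ℤ/3ℤ` are translations, odd ones are reflections. -/
theorem perm_zmod_three (σ : Equiv.Perm (ZMod 3)) :
    ((∀ i, σ (i + 1) = σ i + 1 ∧ σ (i - 1) = σ i - 1) ∧ Equiv.Perm.sign σ = 1) ∨
      ((∀ i, σ (i + 1) = σ i - 1 ∧ σ (i - 1) = σ i + 1) ∧ Equiv.Perm.sign σ = -1) := by
  revert σ; decide

theorem tripleOrder_comp_perm (P : ZMod 3 → C.Point ℚ) (σ : Equiv.Perm (ZMod 3)) (i : ZMod 3) :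
    tripleOrder (P ∘ σ) i = tripleOrder P (σ i) := by
  rcases perm_zmod_three σ with ⟨h, -⟩ | ⟨h, -⟩
  · rw [tripleOrder, tripleOrder, Function.comp_apply, Function.comp_apply, (h i).1, (h i).2]
  · rw [tripleOrder, tripleOrder, Function.comp_apply, Function.comp_apply, (h i).1, (h i).2,
      Point.diffClass_swap, addOrderOf_neg]

theorem tripleRatio_comp_perm (P : ZMod 3 → C.Point ℚ) (σ : Equiv.Perm (ZMod 3)) (i : ZMod 3) :
    tripleRatio (P ∘ σ) i = tripleRatio P (σ i) := by
  have h : tripleLcm (P ∘ σ) = tripleLcm P := by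
    apply Nat.dvd_antisymm <;> rw [tripleLcm_dvd_iff] <;> intro i
    · rw [tripleOrder_comp_perm]
      exact tripleLcm_dvd_iff.1 dvd_rfl _
    · rw [← σ.apply_symm_apply i, ← tripleOrder_comp_perm]
      exact tripleLcm_dvd_iff.1 dvd_rfl _
  exact congrArg₂ (· / ·) h (tripleOrder_comp_perm P σ i)

/-- The normalized functions depend only on the points: both sides have the same divisor and the
value `1` at `P (σ i)`. -/
theorem IsTripleFunctions.normalized_comp_perm (hdist : Function.Injective P)
    {σ : Equiv.Perm (ZMod 3)} {g : ZMod 3 → C.Fˣ} (hf : IsTripleFunctions P f)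
    (hg : IsTripleFunctions (P ∘ σ) g) (i : ZMod 3) :
    normalized (P ∘ σ) g i = normalized P f (σ i) ^ (Equiv.Perm.sign σ : ℤ) := by
  have hv := hf.hasValue_normalized hdist (σ i)
  have hw := hg.hasValue_normalized (hdist.comp σ.injective) i
  have hf' := (hf.isDivisorOf_normalized (σ i)).ordAt_eq
  have hd := hg.isDivisorOf_normalized i
  rw [tripleOrder_comp_perm, Function.comp_apply, Function.comp_apply] at hd
  rcases perm_zmod_three σ with ⟨h, hσ⟩ | ⟨h, hσ⟩
  · rw [(h i).1, (h i).2] at hd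
    have hg' := hd.ordAt_eq
    rw [hσ, Units.val_one, zpow_one, ← mul_inv_eq_one]
    refine eq_one_of_ordAt_eq_zero (P := P (σ i)) (fun x => ?_) ?_
    · rw [ofMul_mul, ofMul_inv, map_add, map_neg, hf', hg', add_neg_cancel]
    · simpa using RationalPlace.HasValue.mul hw hv.inv_one
  · rw [(h i).1, (h i).2] at hd
    have hg' := hd.ordAt_eq
    rw [hσ, Units.val_neg, Units.val_one, zpow_neg_one, ← mul_eq_one_iff_eq_inv]
    refine eq_one_of_ordAt_eq_zero (P := P (σ i)) (fun x => ?_) ?_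
    · rw [ofMul_mul, map_add, hf', hg']
      ring
    · simpa using RationalPlace.HasValue.mul hw hv

theorem IsTripleFunctions.tripleS_comp_perm (hdist : Function.Injective P)
    {σ : Equiv.Perm (ZMod 3)} {g : ZMod 3 → C.Fˣ} (hf : IsTripleFunctions P f)
    (hg : IsTripleFunctions (P ∘ σ) g) (i : ZMod 3) :
    tripleS (P ∘ σ) g i = (Equiv.Perm.sign σ : ℤ) • tripleS P f (σ i) := by
  have h0 : tripleS (P ∘ σ) g i =
      K2.symbol (normalized (P ∘ σ) g (i + 1)) (normalized (P ∘ σ) g (i - 1)) := rfl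
  have h1 : tripleS P f (σ i) =
      K2.symbol (normalized P f (σ i + 1)) (normalized P f (σ i - 1)) := rfl
  rw [h0, h1, hf.normalized_comp_perm hdist hg, hf.normalized_comp_perm hdist hg]
  rcases perm_zmod_three σ with ⟨h, hσ⟩ | ⟨h, hσ⟩
  · rw [(h i).1, (h i).2, hσ]
    simp
  · rw [(h i).1, (h i).2, hσ, Units.val_neg, Units.val_one, zpow_neg_one, zpow_neg_one,
      K2.symbol_inv_left, K2.symbol_inv_right, neg_neg, neg_one_zsmul, ← K2.symbol_swap]

theorem IsTripleElement.comp_perm (hdist : Function.Injective P) {σ : Equiv.Perm (ZMod 3)}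
    {g : ZMod 3 → C.Fˣ} (hf : IsTripleFunctions P f) (hg : IsTripleFunctions (P ∘ σ) g)
    {T : C.K2TModTorsion} (hT : IsTripleElement P f T) :
    IsTripleElement (P ∘ σ) g ((Equiv.Perm.sign σ : ℤ) • T) := by
  obtain ⟨hS, h⟩ := hT
  have hSσ := hf.tripleS_comp_perm hdist hg
  refine ⟨fun i => hSσ i ▸ zsmul_mem (hS (σ i)) _, fun i => ?_⟩
  rw [tripleRatio_comp_perm, smul_comm, ← h (σ i)]
  exact congrArg QuotientAddGroup.mk (Subtype.ext (hSσ i))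

end CurveOverQ

end

theorem proposition4p3 (C : CurveOverQ) (P : ZMod 3 → C.Point ℚ)
    (hdist : Function.Injective P)
    (htors : ∀ i j, IsOfFinAddOrder ((P i).diffClass (P j))) :
    (∃ f : ZMod 3 → C.Fˣ, CurveOverQ.IsTripleFunctions P f) ∧
    (∀ f : ZMod 3 → C.Fˣ, CurveOverQ.IsTripleFunctions P f →
      ∃! T : C.K2TModTorsion, CurveOverQ.IsTripleElement P f T) ∧
    (∀ (σ : Equiv.Perm (ZMod 3)) (f g : ZMod 3 → C.Fˣ),
      CurveOverQ.IsTripleFunctions P f → CurveOverQ.IsTripleFunctions (P ∘ σ) g →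
      ∀ T : C.K2TModTorsion, CurveOverQ.IsTripleElement P f T →
        CurveOverQ.IsTripleElement (P ∘ σ) g ((Equiv.Perm.sign σ : ℤ) • T)) :=
  ⟨CurveOverQ.exists_isTripleFunctions P,
    fun _ hf => hf.existsUnique_isTripleElement hdist htors,
    fun _ _ _ hf hg _ hT => hT.comp_perm hdist hf hg⟩
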